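/- Let $\mathbb D$ be the open unit disk of $\mathbb C$ and $\mathbb T$ its boundary. Let $\omega\neq 0$ be a modulus of continuity, i.e. a nonnegative, nondecreasing, continuous function on $[0,2]$ with $\omega(0)=0$ and $t\mapsto \omega(t)/t$ nonincreasing on $(0,2]$, and suppose that $$\eta_\omega:=\inf_{0<t\le 1}\frac{\omega(t^2)}{\omega(t)}>0 .$$ Let $Lip_\omega$ be the algebra of all functions $f$ that are continuous on $\overline{\mathbb D}$, analytic in $\mathbb D$, and satisfy $\sup_{\xi,\zeta\in\mathbb T,\ \xi\ne\zeta}\frac{|f(\xi)-f(\zeta)|}{\omega(|\xi-\zeta|)}<+\infty$, with the norm $$\|f\|_\omega:=\sup_{z\in\mathbb D}|f(z)|+\sup_{\xi,\zeta\in\mathbb T,\ \xi\ne\zeta}\frac{|f(\xi)-f(\zeta)|}{\omega(|\xi-\zeta|)} .$$ Let $\mathcal I\subseteq Lip_\omega$ be an ideal that is closed for $\|\cdot\|_\omega$, and let $\mathbb E_{\mathcal I}:=\{\xi\in\mathbb T: f(\xi)=0\ \text{for all } f\in\mathcal I\}$. For closed $\mathbb E\subseteq\mathbb T$ and $\delta>0$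 put $\mathbb E(\delta):=\{\xi\in\mathbb T: d(\xi,\mathbb E)\le\delta\}$, where $d$ is the Euclidean distance (with $d(\xi,\emptyset)=\infty$), and let $\mathcal J_\omega(\mathbb E)$ be the set of all $f\in Lip_\omega$ with $f|_{\mathbb E}\equiv 0$ and $$\lim_{\delta\to 0}\ \sup_{\xi,\zeta\in\mathbb E(\delta),\ \xi\ne\zeta}\frac{|f(\xi)-f(\zeta)|}{\omega(|\xi-\zeta|)}=0$$ (a supremum over the empty set being $0$). Let $g\in\mathcal J_\omega(\mathbb E_{\mathcal I})$. Suppose that $gf\in\mathcal I$ for some outer function $f\in Lip_\omega$, that is, a function $f \in Lip_\omega$ such that $\log|f|$ is integrable on $\mathbb T$ and, for some constant $c$ with $|c|=1$, $$f(z)=c\,\exp\Big\{\frac1{2\pi}\int_{\mathbb T}\frac{\xi+z}{\xi-z}\log|f(\xi)|\,|d\xi|\Big\},\qquad z\in\mathbb D .$$ Then $g\in\mathcal I$. -/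

import Mathlib

open Metric Set

/-- A modulus of continuity: a nonnegative nondecreasing continuous function `ω ≠ 0` on `[0, 2]`
with `ω 0 = 0` and `t ↦ ω t / t` nonincreasing. (Values outside `[0, 2]` play no role.) -/
structure ModulusOfContinuity where
  toFun : ℝ → ℝ
  nonneg' : ∀ t ∈ Icc (0 : ℝ) 2, 0 ≤ toFun t
  monotoneOn' : MonotoneOn toFun (Icc 0 2)
  continuousOn' : ContinuousOn toFun (Icc 0 2)
  zero' : toFun 0 = 0
  antitoneOn' : AntitoneOn (fun t => toFun t / t) (Ioc 0 2)
  ne_zero' : ∃ t ∈ Icc (0 : ℝ) 2, toFun t ≠ 0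

instance : CoeFun ModulusOfContinuity (fun _ => ℝ → ℝ) := ⟨ModulusOfContinuity.toFun⟩

/-- The constant `η_ω = inf_{0 < t ≤ 1} ω(t²) / ω(t)`. -/
noncomputable def ModulusOfContinuity.eta (ω : ModulusOfContinuity) : ℝ :=
  sInf ((fun t : ℝ => ω (t ^ 2) / ω t) '' Ioc 0 1)

/-- The closed unit disc. -/
abbrev ClosedDisc : Type := closedBall (0 : ℂ) 1

/-- A function on the closed unit disc, extended by `0` to all of `ℂ`. -/
noncomputable def discExt (f : ClosedDisc → ℂ) (z : ℂ) : ℂ :=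
  open Classical in if h : z ∈ closedBall (0 : ℂ) 1 then f ⟨z, h⟩ else 0

theorem discExt_of_mem (f : ClosedDisc → ℂ) {z : ℂ} (h : z ∈ closedBall (0 : ℂ) 1) :
    discExt f z = f ⟨z, h⟩ := by
  simp only [discExt, dif_pos h]

theorem discExt_add (f g : C(ClosedDisc, ℂ)) :
    discExt ⇑(f + g) = discExt f + discExt g := by
  funext z
  by_cases h : z ∈ closedBall (0 : ℂ) 1 <;> simp only [discExt, h, Pi.add_apply] <;> simp

theorem discExt_mul (f g : C(ClosedDisc, ℂ)) :
    discExt ⇑(f * g) = discExt f * discExt g := by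
  funext z
  by_cases h : z ∈ closedBall (0 : ℂ) 1 <;> simp only [discExt, h, Pi.mul_apply] <;> simp

/-- The disc algebra `𝒜(𝔻)`: continuous functions on the closed unit disc that are analytic in
the open unit disc. -/
noncomputable def DiscAlgebra : Subalgebra ℂ C(ClosedDisc, ℂ) where
  carrier := {f | DifferentiableOn ℂ (discExt f) (ball 0 1)}
  mul_mem' := by
    intro f g hf hg
    simp only [mem_ofPred_eq, discExt_mul] at *
    exact hf.mul hg
  add_mem' := by
    intro f g hf hg
    simp only [mem_ofPred_eq, discExt_add] at *
    exact hf.add hg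
  algebraMap_mem' := by
    intro c
    refine (differentiableOn_const c).congr fun z hz => ?_
    rw [discExt_of_mem _ (ball_subset_closedBall hz)]
    rfl

/-- The set of difference quotients `|f ξ - f ζ| / ω |ξ - ζ|` over distinct points `ξ, ζ` of a
set `S`. -/
def lipQuotients (ω : ModulusOfContinuity) (f : ℂ → ℂ) (S : Set ℂ) : Set ℝ :=
  {r | ∃ ξ ∈ S, ∃ ζ ∈ S, ξ ≠ ζ ∧ r = ‖f ξ - f ζ‖ / ω ‖ξ - ζ‖}

theorem discExt_bounded (f : C(ClosedDisc, ℂ)) : ∃ M : ℝ, 0 ≤ M ∧ ∀ z, ‖discExt f z‖ ≤ M := by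
  have hc : CompactSpace ClosedDisc := isCompact_iff_compactSpace.mp (isCompact_closedBall 0 1)
  refine ⟨‖f‖, norm_nonneg _, fun z => ?_⟩
  by_cases h : z ∈ closedBall (0 : ℂ) 1
  · rw [discExt_of_mem _ h]; exact f.norm_coe_le_norm _
  · simp only [discExt, dif_neg h, norm_zero]; exact norm_nonneg _

theorem ModulusOfContinuity.nonneg_sphere (ω : ModulusOfContinuity) {ξ ζ : ℂ}
    (hξ : ξ ∈ sphere (0 : ℂ) 1) (hζ : ζ ∈ sphere (0 : ℂ) 1) : 0 ≤ ω ‖ξ - ζ‖ := by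
  rw [mem_sphere_zero_iff_norm] at hξ hζ
  refine ω.nonneg' _ ⟨norm_nonneg _, (norm_sub_le _ _).trans ?_⟩
  rw [hξ, hζ]; norm_num

/-- The weighted big Lipschitz algebra `Lip_ω = Lip_ω(𝕋)`: the functions of the disc algebra with
`sup_{ξ ≠ ζ ∈ 𝕋} |f ξ - f ζ| / ω |ξ - ζ| < ∞`. -/
noncomputable def LipAlgebra (ω : ModulusOfContinuity) : Subalgebra ℂ C(ClosedDisc, ℂ) where
  carrier := {f | f ∈ DiscAlgebra ∧ BddAbove (lipQuotients ω (discExt f) (sphere 0 1))}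
  mul_mem' := by
    rintro f g ⟨hf, A, hA⟩ ⟨hg, B, hB⟩
    refine ⟨mul_mem hf hg, ?_⟩
    obtain ⟨M, hM0, hM⟩ := discExt_bounded f
    obtain ⟨N, hN0, hN⟩ := discExt_bounded g
    refine ⟨M * B + N * A, ?_⟩
    rintro r ⟨ξ, hξ, ζ, hζ, hne, rfl⟩
    have h1 := hA ⟨ξ, hξ, ζ, hζ, hne, rfl⟩
    have h2 := hB ⟨ξ, hξ, ζ, hζ, hne, rfl⟩
    have hω := ω.nonneg_sphere hξ hζ
    have key : ‖discExt (⇑(f * g)) ξ - discExt (⇑(f * g)) ζ‖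
        ≤ M * ‖discExt g ξ - discExt g ζ‖ + N * ‖discExt f ξ - discExt f ζ‖ := by
      rw [discExt_mul]
      have : (discExt f * discExt g) ξ - (discExt f * discExt g) ζ
          = discExt f ξ * (discExt g ξ - discExt g ζ)
            + discExt g ζ * (discExt f ξ - discExt f ζ) := by
        simp only [Pi.mul_apply]; ring
      rw [this]
      refine (norm_add_le _ _).trans ?_
      rw [norm_mul, norm_mul]
      gcongr
      · exact hM ξ
      · exact hN ζ
    calc _ ≤ (M * ‖discExt g ξ - discExt g ζ‖ + N * ‖discExt f ξ - discExt f ζ‖)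
            / ω ‖ξ - ζ‖ := by gcongr
      _ = M * (‖discExt g ξ - discExt g ζ‖ / ω ‖ξ - ζ‖)
            + N * (‖discExt f ξ - discExt f ζ‖ / ω ‖ξ - ζ‖) := by ring
      _ ≤ _ := by gcongr
  add_mem' := by
    rintro f g ⟨hf, A, hA⟩ ⟨hg, B, hB⟩
    refine ⟨add_mem hf hg, A + B, ?_⟩
    rintro r ⟨ξ, hξ, ζ, hζ, hne, rfl⟩
    have h1 := hA ⟨ξ, hξ, ζ, hζ, hne, rfl⟩
    have h2 := hB ⟨ξ, hξ, ζ, hζ, hne, rfl⟩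
    have hω := ω.nonneg_sphere hξ hζ
    have key : ‖discExt (⇑(f + g)) ξ - discExt (⇑(f + g)) ζ‖
        ≤ ‖discExt f ξ - discExt f ζ‖ + ‖discExt g ξ - discExt g ζ‖ := by
      rw [discExt_add, Pi.add_apply, Pi.add_apply, add_sub_add_comm]
      exact norm_add_le _ _
    calc _ ≤ (‖discExt f ξ - discExt f ζ‖ + ‖discExt g ξ - discExt g ζ‖)
            / ω ‖ξ - ζ‖ := by gcongr
      _ = ‖discExt f ξ - discExt f ζ‖ / ω ‖ξ - ζ‖
            + ‖discExt g ξ - discExt g ζ‖ / ω ‖ξ - ζ‖ := by ring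
      _ ≤ _ := add_le_add h1 h2
  algebraMap_mem' := by
    intro c
    refine ⟨algebraMap_mem DiscAlgebra c, 0, ?_⟩
    rintro r ⟨ξ, hξ, ζ, hζ, hne, rfl⟩
    rw [discExt_of_mem _ (sphere_subset_closedBall hξ),
      discExt_of_mem _ (sphere_subset_closedBall hζ)]
    simp

/-- A function of `Lip_ω` as a function on `ℂ` (its genuine values on the closed unit disc). -/
noncomputable def lipFun {ω : ModulusOfContinuity} (f : LipAlgebra ω) : ℂ → ℂ :=
  discExt f.1

/-- The norm `‖f‖_ω = sup_{z ∈ 𝔻} |f z| + sup_{ξ ≠ ζ ∈ 𝕋} |f ξ - f ζ| / ω |ξ - ζ|` of `Lip_ω`.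
(The type `LipAlgebra ω` inherits the mere supremum norm from Mathlib; that one is not used.) -/
noncomputable def LipAlgebra.lipNorm {ω : ModulusOfContinuity} (f : LipAlgebra ω) : ℝ :=
  sSup ((fun z => ‖lipFun f z‖) '' ball (0 : ℂ) 1) + sSup (lipQuotients ω (lipFun f) (sphere 0 1))

/-- The ideal `I` of `Lip_ω` is closed with respect to the norm `‖·‖_ω`: it contains every `h`
that is approximated in this norm by elements of `I`. -/
def LipAlgebra.IsNormClosed {ω : ModulusOfContinuity} (I : Ideal (LipAlgebra ω)) : Prop :=
  ∀ h : LipAlgebra ω, (∀ ε : ℝ, 0 < ε → ∃ k ∈ I, LipAlgebra.lipNorm (h - k) < ε) → h ∈ I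

/-- The hull `E_I = {ξ ∈ 𝕋 : f ξ = 0 for all f ∈ I}`. -/
def LipAlgebra.hull {ω : ModulusOfContinuity} (I : Ideal (LipAlgebra ω)) : Set ℂ :=
  {ξ | ξ ∈ sphere (0 : ℂ) 1 ∧ ∀ f ∈ I, lipFun f ξ = 0}

/-- `E(δ) = {ξ ∈ 𝕋 : d(ξ, E) ≤ δ}`; the distance to the empty set is `∞`. -/
def circleNhd (E : Set ℂ) (δ : ℝ) : Set ℂ := sphere (0 : ℂ) 1 ∩ cthickening δ E

/-- The space `J_ω(E)`: the functions `f ∈ Lip_ω` that vanish on `E` and satisfy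
`lim_{δ → 0} sup_{ξ ≠ ζ ∈ E(δ)} |f ξ - f ζ| / ω |ξ - ζ| = 0`. -/
def LipAlgebra.smallSpace (ω : ModulusOfContinuity) (E : Set ℂ) : Set (LipAlgebra ω) :=
  {f | (∀ ξ ∈ E, lipFun f ξ = 0) ∧
    ∀ ε : ℝ, 0 < ε → ∃ δ : ℝ, 0 < δ ∧ ∀ r ∈ lipQuotients ω (lipFun f) (circleNhd E δ), r ≤ ε}

/-- `f` is an outer function: `log |f|` is integrable on the unit circle and, for some unimodular
constant `c`,
`f z = c * exp ((1 / 2π) ∫_𝕋 ((ξ + z) / (ξ - z)) log |f ξ| |dξ|)` in the open unit disc.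
(In particular `f` is not the zero function.) -/
def LipAlgebra.IsOuter {ω : ModulusOfContinuity} (f : LipAlgebra ω) : Prop :=
  CircleIntegrable (fun ξ => Real.log ‖lipFun f ξ‖) 0 1 ∧
    ∃ c : ℂ, ‖c‖ = 1 ∧ ∀ z ∈ ball (0 : ℂ) 1,
      lipFun f z = c * Complex.exp
        (Real.circleAverage (fun ξ => (ξ + z) / (ξ - z) * (Real.log ‖lipFun f ξ‖ : ℂ)) 0 1)

/-!
Normalise the outer function so that `‖f‖ ≤ 1` and `f = c * exp (-∫ (ξ + z) / (ξ - z) dν)` with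
`ν ≪` arc length, and let `K` be the ideal of all `k` with `g * k ∈ I`; its common zeros in the
closed disc lie in `E = hull I`. If `E` is empty, then a Bezout identity in the disc algebra,
approximated in `Lip_ω`, gives `1 ∈ K`. If `E` has positive length, then `g = 0`, as `g` vanishes
on `E`.

If `E` has length zero, cut the circle into `M` equal arcs, and let `Γ` be the union of those close
to `E` and `Γ'` the union of the others. The parts of `ν` on `Γ` and `Γ'` split `f` into two outer
functions, and multiplying each by rational functions that vanish at the finite set `Γ ∩ Γ'` puts
it into `Lip_ω`. The product of the two damped factors lies in `K` and the one belonging to `Γ'`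
has no zero on `E`, so the other one, `V_M`, lies in `K`. As `M → ∞`, `V_M → 1` off `E`, while near
`E` the increments of `V_M` lose at most a negative power of the distance to `E`. The
condition `η_ω > 0` makes `ω (t ^ 8)` comparable to `ω t` and so absorbs this loss into the factor
`ω (d (ξ, E))` by which `g ∈ J_ω(E)` is small near `E`. Hence `g * V_M → g` in norm, and `I` is
closed.
-/

/-! ### Moduli of continuity -/

namespace ModulusOfContinuity

variable (ω : ModulusOfContinuity)

theorem pos {t : ℝ} (h0 : 0 < t) (h2 : t ≤ 2) : 0 < ω t := by
  refine lt_of_le_of_ne (ω.nonneg' t ⟨h0.le, h2⟩) fun h => ?_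
  obtain ⟨s, hs, hne⟩ := ω.ne_zero'
  refine hne (le_antisymm ?_ (ω.nonneg' s hs))
  rcases le_total s t with hst | hst
  · exact (ω.monotoneOn' hs ⟨h0.le, h2⟩ hst).trans h.ge
  · have hs' : 0 < s := h0.trans_le hst
    have hdiv : ω s / s ≤ ω t / t := ω.antitoneOn' ⟨h0, h2⟩ ⟨hs', hs.2⟩ hst
    rwa [← h, zero_div, div_le_iff₀ hs', zero_mul] at hdiv

theorem div_le_div {s t : ℝ} (hs : 0 < s) (hst : s ≤ t) (ht : t ≤ 2) : ω t / t ≤ ω s / s :=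
  ω.antitoneOn' ⟨hs, hst.trans ht⟩ ⟨hs.trans_le hst, ht⟩ hst

theorem le_of_le {s t : ℝ} (hs : 0 ≤ s) (hst : s ≤ t) (ht : t ≤ 2) : ω s ≤ ω t :=
  ω.monotoneOn' ⟨hs, hst.trans ht⟩ ⟨hs.trans hst, ht⟩ hst

theorem mul_le_mul {s t : ℝ} (hs : 0 ≤ s) (hst : s ≤ t) (ht : t ≤ 2) : s * ω t ≤ t * ω s := by
  rcases hs.eq_or_lt with rfl | hs
  · simp [ω.zero']
  · have hdiv := ω.div_le_div hs hst ht
    rwa [div_le_div_iff₀ (hs.trans_le hst) hs, mul_comm, mul_comm (ω s)] at hdiv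

theorem self_le_mul {t : ℝ} (h0 : 0 ≤ t) (h2 : t ≤ 2) : t ≤ 2 / ω 2 * ω t := by
  rw [div_mul_eq_mul_div, le_div_iff₀ (ω.pos two_pos le_rfl)]
  exact ω.mul_le_mul h0 h2 le_rfl

theorem le_two_mul_half {t : ℝ} (h0 : 0 ≤ t) (h2 : t ≤ 2) : ω t ≤ 2 * ω (t / 2) := by
  rcases h0.eq_or_lt with rfl | h0
  · simp [ω.zero']
  · have := ω.mul_le_mul (half_pos h0).le (half_le_self h0.le) h2
    exact le_of_mul_le_mul_left (by linarith) h0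

theorem eta_mul_le {t : ℝ} (h0 : 0 < t) (h1 : t ≤ 1) : ω.eta * ω t ≤ ω (t ^ 2) := by
  have hbdd : BddBelow ((fun t : ℝ => ω (t ^ 2) / ω t) '' Ioc 0 1) := by
    refine ⟨0, ?_⟩
    rintro _ ⟨s, hs, rfl⟩
    exact div_nonneg (ω.nonneg' _ ⟨by positivity, by nlinarith [hs.1, hs.2]⟩)
      (ω.nonneg' _ ⟨hs.1.le, by linarith [hs.2]⟩)
  exact (le_div_iff₀ (ω.pos h0 (by linarith))).1 (csInf_le hbdd ⟨t, ⟨h0, h1⟩, rfl⟩)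

theorem eta_pow_mul_le (hω : 0 < ω.eta) {t : ℝ} (h0 : 0 < t) (h1 : t ≤ 1) (n : ℕ) :
    ω.eta ^ n * ω t ≤ ω (t ^ 2 ^ n) := by
  induction n with
  | zero => simp
  | succ n ih =>
    calc ω.eta ^ (n + 1) * ω t = ω.eta * (ω.eta ^ n * ω t) := by ring
      _ ≤ ω.eta * ω (t ^ 2 ^ n) := by gcongr
      _ ≤ ω ((t ^ 2 ^ n) ^ 2) := ω.eta_mul_le (by positivity) (pow_le_one₀ h0.le h1)
      _ = ω (t ^ 2 ^ (n + 1)) := by rw [← pow_mul, ← pow_succ]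

theorem apply_two_mul_le (hω : 0 < ω.eta) {s : ℝ} (h0 : 0 < s) (h1 : s ≤ 1) :
    ω (2 * s) ≤ 2 / ω.eta ^ 3 * ω (s ^ 8) := by
  have hhalf : ω (2 * s) ≤ 2 * ω s := by
    have := ω.le_two_mul_half (t := 2 * s) (by linarith) (by linarith)
    rwa [mul_div_cancel_left₀ s two_ne_zero] at this
  have hη : ω.eta ^ 3 * ω s ≤ ω (s ^ 8) := ω.eta_pow_mul_le hω h0 h1 3
  rw [div_mul_eq_mul_div, le_div_iff₀ (pow_pos hω 3)]
  nlinarith [pow_pos hω 3]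

theorem mul_apply_two_mul_le (hω : 0 < ω.eta) {s t D L C : ℝ} (hs0 : 0 < s) (hs1 : s ≤ 1)
    (ht0 : 0 ≤ t) (ht2 : t ≤ 2) (hL : 0 ≤ L) (hC : 0 ≤ C) (hD2 : D ≤ 2)
    (hD : D ≤ L * ω t + C * (t / s ^ 8)) :
    D * ω (2 * s) ≤ (L * ω 2 + (2 + C) * (2 / ω.eta ^ 3)) * ω t := by
  have hs8 : 0 < s ^ 8 := pow_pos hs0 8
  have hωt : 0 ≤ ω t := ω.nonneg' t ⟨ht0, ht2⟩
  have hω2 : 0 < ω 2 := ω.pos two_pos le_rfl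
  have hω2s : 0 < ω (2 * s) := ω.pos (by linarith) (by linarith)
  have hη : 0 ≤ 2 / ω.eta ^ 3 := by positivity
  have hbound := ω.apply_two_mul_le hω hs0 hs1
  rcases le_or_gt (s ^ 8) t with h | h
  · calc D * ω (2 * s) ≤ 2 * (2 / ω.eta ^ 3 * ω t) :=
          _root_.mul_le_mul hD2 (hbound.trans (mul_le_mul_of_nonneg_left
            (ω.le_of_le hs8.le h ht2) hη)) hω2s.le two_pos.le
      _ = (0 + (2 + 0) * (2 / ω.eta ^ 3)) * ω t := by ring
      _ ≤ (L * ω 2 + (2 + C) * (2 / ω.eta ^ 3)) * ω t := by gcongr; positivity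
  · have hratio : t / s ^ 8 * ω (s ^ 8) ≤ ω t := by
      rw [div_mul_eq_mul_div, div_le_iff₀ hs8, mul_comm (ω t)]
      exact ω.mul_le_mul ht0 h.le ((pow_le_one₀ hs0.le hs1).trans one_le_two)
    calc D * ω (2 * s) ≤ (L * ω t + C * (t / s ^ 8)) * ω (2 * s) := by gcongr
      _ = L * ω t * ω (2 * s) + C * (t / s ^ 8) * ω (2 * s) := by ring
      _ ≤ L * ω t * ω 2 + C * (t / s ^ 8) * (2 / ω.eta ^ 3 * ω (s ^ 8)) := by
          gcongr
          exact ω.le_of_le (by linarith) (by linarith) le_rfl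
      _ = L * ω 2 * ω t + C * (2 / ω.eta ^ 3) * (t / s ^ 8 * ω (s ^ 8)) := by ring
      _ ≤ L * ω 2 * ω t + C * (2 / ω.eta ^ 3) * ω t := by gcongr
      _ = (L * ω 2 + (0 + C) * (2 / ω.eta ^ 3)) * ω t := by ring
      _ ≤ (L * ω 2 + (2 + C) * (2 / ω.eta ^ 3)) * ω t := by gcongr; exact two_pos.le

end ModulusOfContinuity

theorem norm_sub_le_two_of_sphere {ξ ζ : ℂ} (hξ : ξ ∈ sphere (0 : ℂ) 1)
    (hζ : ζ ∈ sphere (0 : ℂ) 1) : ‖ξ - ζ‖ ≤ 2 := by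
  rw [mem_sphere_zero_iff_norm] at hξ hζ
  linarith [norm_sub_le ξ ζ]

/-! ### The disc algebra -/

theorem exists_forall_dist_dilation_lt {Y : Type*} [PseudoMetricSpace Y] {F : ℂ → Y}
    (hF : ContinuousOn F (closedBall 0 1)) {ε : ℝ} (hε : 0 < ε) :
    ∃ r ∈ Ioo (0 : ℝ) 1, ∀ z ∈ closedBall (0 : ℂ) 1, dist (F z) (F (r * z)) < ε := by
  have huc := (isCompact_closedBall (0 : ℂ) 1).uniformContinuousOn_of_continuous hF
  obtain ⟨δ, hδ, h⟩ := Metric.uniformContinuousOn_iff.1 huc ε hε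
  obtain ⟨r, hr, hr1⟩ : ∃ r, max (1 - δ) 0 < r ∧ r < 1 :=
    exists_between (max_lt (by linarith) one_pos)
  rw [max_lt_iff] at hr
  refine ⟨r, ⟨hr.2, hr1⟩, fun z hz => ?_⟩
  have hz1 := mem_closedBall_zero_iff.1 hz
  refine h z hz _ (mem_closedBall_zero_iff.2 ?_) ?_
  · rw [norm_mul, Complex.norm_of_nonneg hr.2.le]
    exact mul_le_one₀ hr1.le (norm_nonneg z) hz1
  · calc dist z (r * z) = ‖((1 - r : ℝ) : ℂ) * z‖ := by rw [dist_eq_norm]; push_cast; ring_nf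
      _ = (1 - r) * ‖z‖ := by rw [norm_mul, Complex.norm_of_nonneg (by linarith)]
      _ ≤ 1 - r := mul_le_of_le_one_right (by linarith) hz1
      _ < δ := by linarith

theorem exists_polynomial_dist_eval_lt {F : ℂ → ℂ} (hF : DifferentiableOn ℂ F (ball 0 1)) {r : ℝ}
    (hr : r < 1) {ε : ℝ} (hε : 0 < ε) :
    ∃ p : Polynomial ℂ, ∀ z ∈ closedBall (0 : ℂ) r, dist (F z) (p.eval z) < ε := by
  obtain ⟨s, hs, hs1⟩ := exists_between (max_lt hr one_pos)
  rw [max_lt_iff] at hs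
  obtain ⟨t, ht, hts⟩ := exists_between (max_lt hs.1 hs.2)
  rw [max_lt_iff] at ht
  lift s to NNReal using hs.2.le
  lift t to NNReal using ht.2.le
  have hpow := (hF.mono (closedBall_subset_ball hs1)).hasFPowerSeriesOnBall
    (c := (0 : ℂ)) (NNReal.coe_pos.1 hs.2)
  have hunif := hpow.tendstoUniformlyOn (r' := t) (ENNReal.coe_lt_coe.2 (NNReal.coe_lt_coe.1 hts))
  obtain ⟨n, hn⟩ := (Metric.tendstoUniformlyOn_iff.1 hunif ε hε).exists
  refine ⟨∑ k ∈ Finset.range n,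
    Polynomial.C ((cauchyPowerSeries F 0 s).coeff k) * Polynomial.X ^ k, fun z hz => ?_⟩
  have heval : Polynomial.eval z (∑ k ∈ Finset.range n,
      Polynomial.C ((cauchyPowerSeries F 0 s).coeff k) * Polynomial.X ^ k)
      = (cauchyPowerSeries F 0 s).partialSum n z := by
    simp only [Polynomial.eval_finsetSum, FormalMultilinearSeries.partialSum, Polynomial.eval_mul,
      Polynomial.eval_C, Polynomial.eval_pow, Polynomial.eval_X,
      FormalMultilinearSeries.apply_eq_pow_smul_coeff, smul_eq_mul, mul_comm]
  rw [heval, ← zero_add z]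
  convert hn z (mem_ball_zero_iff.2 ((mem_closedBall_zero_iff.1 hz).trans_lt ht.1)) using 2
  rw [zero_add]

theorem exists_polynomial_dist_eval_lt_of_continuousOn {F : ℂ → ℂ}
    (hc : ContinuousOn F (closedBall 0 1)) (hd : DifferentiableOn ℂ F (ball 0 1)) {ε : ℝ}
    (hε : 0 < ε) :
    ∃ p : Polynomial ℂ, ∀ z ∈ closedBall (0 : ℂ) 1, dist (F z) (p.eval z) < ε := by
  obtain ⟨r, ⟨hr0, hr1⟩, hr⟩ := exists_forall_dist_dilation_lt hc (half_pos hε)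
  obtain ⟨p, hp⟩ := exists_polynomial_dist_eval_lt hd hr1 (half_pos hε)
  refine ⟨p.comp (Polynomial.C (r : ℂ) * Polynomial.X), fun z hz => ?_⟩
  have hrz : (r : ℂ) * z ∈ closedBall (0 : ℂ) r := by
    rw [mem_closedBall_zero_iff, norm_mul, Complex.norm_of_nonneg hr0.le]
    exact mul_le_of_le_one_right hr0.le (mem_closedBall_zero_iff.1 hz)
  calc dist (F z) ((p.comp (Polynomial.C (r : ℂ) * Polynomial.X)).eval z)
      ≤ dist (F z) (F (r * z)) + dist (F (r * z)) (p.eval (r * z)) := by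
        simpa using dist_triangle (F z) (F (r * z)) (p.eval (r * z))
    _ < ε / 2 + ε / 2 := add_lt_add (hr z hz) (hp _ hrz)
    _ = ε := add_halves ε

theorem continuousOn_discExt (f : C(ClosedDisc, ℂ)) :
    ContinuousOn (discExt f) (closedBall 0 1) := by
  rw [continuousOn_iff_continuous_domRestrict]
  exact f.continuous.congr fun z => (discExt_of_mem _ z.2).symm

namespace DiscAlgebra

/-- The coordinate function `z` as an element of the disc algebra. -/
noncomputable def id : DiscAlgebra :=
  ⟨⟨Subtype.val, continuous_subtype_val⟩,
    differentiableOn_id.congr fun _ hz => discExt_of_mem _ (ball_subset_closedBall hz)⟩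

/-- Evaluation at a point of the closed disc, as a character of the disc algebra. -/
noncomputable def eval (w : ClosedDisc) : DiscAlgebra →ₐ[ℂ] ℂ :=
  (ContinuousMap.evalAlgHom ℂ ℂ w).comp DiscAlgebra.val

theorem dense_adjoin_id : Dense (Algebra.adjoin ℂ {id} : Set DiscAlgebra) := by
  refine Metric.dense_iff.2 fun f ε hε => ?_
  obtain ⟨p, hp⟩ := exists_polynomial_dist_eval_lt_of_continuousOn (continuousOn_discExt f.1)
    f.2 hε
  refine ⟨Polynomial.aeval id p, ?_, Polynomial.aeval_mem_adjoin_singleton ℂ id⟩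
  rw [mem_ball', Subtype.dist_eq, ContinuousMap.dist_lt_iff hε]
  intro z
  have heval : (Polynomial.aeval id p : DiscAlgebra).1 z = p.eval (z : ℂ) := by
    rw [← Polynomial.coe_aeval_eq_eval]
    exact (Polynomial.aeval_algHom_apply (eval z) id p).symm
  rw [heval, ← discExt_of_mem f.1 z.2]
  exact hp z z.2

theorem isClosed : IsClosed (DiscAlgebra : Set C(ClosedDisc, ℂ)) := by
  refine isClosed_of_closure_subset fun f hf => ?_
  obtain ⟨u, hu, hlim⟩ := mem_closure_iff_seq_limit.1 hf
  have hunif : TendstoUniformlyOn (fun n => discExt (u n)) (discExt f) Filter.atTop (ball 0 1) := by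
    rw [ContinuousMap.tendsto_iff_tendstoUniformly] at hlim
    intro V hV
    filter_upwards [hlim V hV] with n hn z hz
    rw [discExt_of_mem _ (ball_subset_closedBall hz), discExt_of_mem _ (ball_subset_closedBall hz)]
    exact hn _
  exact hunif.tendstoLocallyUniformlyOn.differentiableOn (Filter.Eventually.of_forall hu)
    isOpen_ball

instance : CompleteSpace DiscAlgebra := isClosed.completeSpace_coe

instance : NormOneClass DiscAlgebra := by
  have : Nonempty ClosedDisc := ⟨0, mem_closedBall_self zero_le_one⟩
  exact ⟨norm_one (α := C(ClosedDisc, ℂ))⟩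

theorem norm_id_le : ‖id‖ ≤ 1 :=
  (ContinuousMap.norm_le _ zero_le_one).2 fun z => mem_closedBall_zero_iff.1 z.2

theorem exists_eq_eval (χ : DiscAlgebra →ₐ[ℂ] ℂ) : ∃ w, χ = eval w := by
  let w : ClosedDisc := ⟨χ id, mem_closedBall_zero_iff.2
    ((AlgHom.norm_apply_le_self χ id).trans norm_id_le)⟩
  refine ⟨w, AlgHom.coe_fn_injective (Continuous.ext_on dense_adjoin_id
    (map_continuous χ) (map_continuous (eval w)) ?_)⟩
  exact AlgHom.eqOn_adjoin_iff.2 (by rintro _ rfl; rfl)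

theorem exists_forall_mem_eval_eq_zero {J : Ideal DiscAlgebra} (hJ : J ≠ ⊤) :
    ∃ w, ∀ f ∈ J, eval w f = 0 := by
  obtain ⟨M, hM, hJM⟩ := Ideal.exists_le_maximal J hJ
  obtain ⟨w, hw⟩ := exists_eq_eval (WeakDual.CharacterSpace.toAlgHom M.toCharacterSpace)
  exact ⟨w, fun f hf => hw ▸ M.toCharacterSpace_apply_eq_zero_of_mem (hJM hf)⟩

end DiscAlgebra

/-! ### Ideals of `Lip_ω` without common zeros -/

namespace LipAlgebra

variable {ω : ModulusOfContinuity}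

theorem lipFun_add (f g : LipAlgebra ω) (z : ℂ) : lipFun (f + g) z = lipFun f z + lipFun g z :=
  congrFun (discExt_add f.1 g.1) z

theorem lipFun_mul (f g : LipAlgebra ω) (z : ℂ) : lipFun (f * g) z = lipFun f z * lipFun g z :=
  congrFun (discExt_mul f.1 g.1) z

theorem lipFun_algebraMap (c : ℂ) {z : ℂ} (hz : z ∈ closedBall (0 : ℂ) 1) :
    lipFun (algebraMap ℂ (LipAlgebra ω) c) z = c :=
  discExt_of_mem _ hz

theorem lipFun_one {z : ℂ} (hz : z ∈ closedBall (0 : ℂ) 1) :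
    lipFun (1 : LipAlgebra ω) z = 1 :=
  discExt_of_mem _ hz

theorem lipFun_sub (f g : LipAlgebra ω) (z : ℂ) : lipFun (f - g) z = lipFun f z - lipFun g z := by
  rw [eq_sub_iff_add_eq, ← lipFun_add, sub_add_cancel]

theorem ext_lipFun {f g : LipAlgebra ω} (h : ∀ z ∈ closedBall (0 : ℂ) 1, lipFun f z = lipFun g z) :
    f = g := by
  refine Subtype.ext (ContinuousMap.ext fun z => ?_)
  have hz := h z z.2
  rwa [lipFun, lipFun, discExt_of_mem _ z.2, discExt_of_mem _ z.2] at hz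

theorem continuousOn_lipFun (f : LipAlgebra ω) : ContinuousOn (lipFun f) (closedBall 0 1) :=
  continuousOn_discExt f.1

theorem differentiableOn_lipFun (f : LipAlgebra ω) : DifferentiableOn ℂ (lipFun f) (ball 0 1) :=
  f.2.1

theorem diffContOnCl_lipFun (f : LipAlgebra ω) : DiffContOnCl ℂ (lipFun f) (ball 0 1) :=
  ⟨differentiableOn_lipFun f, by
    rw [closure_ball _ one_ne_zero]; exact continuousOn_lipFun f⟩

/-- The supremum of `|f|` over the open disc. -/
noncomputable def supNorm (f : LipAlgebra ω) : ℝ := sSup ((fun z => ‖lipFun f z‖) '' ball (0 : ℂ) 1)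

/-- The Lipschitz seminorm of `f` on the circle. -/
noncomputable def lipSeminorm (f : LipAlgebra ω) : ℝ :=
  sSup (lipQuotients ω (lipFun f) (sphere 0 1))

theorem lipNorm_eq (f : LipAlgebra ω) : lipNorm f = supNorm f + lipSeminorm f := rfl

theorem norm_lipFun_le (f : LipAlgebra ω) {z : ℂ} (hz : z ∈ closedBall (0 : ℂ) 1) :
    ‖lipFun f z‖ ≤ supNorm f := by
  obtain ⟨M, -, hM⟩ := discExt_bounded f.1
  have hbdd : BddAbove ((fun z => ‖lipFun f z‖) '' ball (0 : ℂ) 1) :=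
    ⟨M, by rintro _ ⟨w, -, rfl⟩; exact hM w⟩
  have hball : MapsTo (lipFun f) (ball 0 1) (closedBall 0 (supNorm f)) := fun w hw =>
    mem_closedBall_zero_iff.2 (le_csSup hbdd ⟨w, hw, rfl⟩)
  have hclosure := hball.closure_of_continuousOn (diffContOnCl_lipFun f).2
  rw [closure_ball _ one_ne_zero, isClosed_closedBall.closure_eq] at hclosure
  exact mem_closedBall_zero_iff.1 (hclosure hz)

theorem supNorm_nonneg (f : LipAlgebra ω) : 0 ≤ supNorm f :=
  (norm_nonneg _).trans (norm_lipFun_le f (mem_closedBall_self zero_le_one))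

theorem supNorm_le {f : LipAlgebra ω} {a : ℝ} (h : ∀ z ∈ ball (0 : ℂ) 1, ‖lipFun f z‖ ≤ a) :
    supNorm f ≤ a := by
  refine csSup_le ⟨_, 0, mem_ball_self one_pos, rfl⟩ ?_
  rintro _ ⟨z, hz, rfl⟩
  exact h z hz

theorem supNorm_le_of_sphere {f : LipAlgebra ω} {a : ℝ}
    (h : ∀ z ∈ sphere (0 : ℂ) 1, ‖lipFun f z‖ ≤ a) : supNorm f ≤ a := by
  refine supNorm_le fun z hz => ?_
  refine Complex.norm_le_of_forall_mem_frontier_norm_le isBounded_ball (diffContOnCl_lipFun f)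
    (fun w hw => h w ?_) (subset_closure hz)
  rwa [frontier_ball _ one_ne_zero] at hw

theorem norm_lipFun_sub_le (f : LipAlgebra ω) {ξ ζ : ℂ} (hξ : ξ ∈ sphere (0 : ℂ) 1)
    (hζ : ζ ∈ sphere (0 : ℂ) 1) :
    ‖lipFun f ξ - lipFun f ζ‖ ≤ lipSeminorm f * ω ‖ξ - ζ‖ := by
  by_cases hne : ξ = ζ
  · simp [hne, ω.zero']
  · have h0 : 0 < ω ‖ξ - ζ‖ :=
      ω.pos (norm_pos_iff.2 (sub_ne_zero.2 hne)) (norm_sub_le_two_of_sphere hξ hζ)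
    rw [← div_le_iff₀ h0]
    exact le_csSup f.2.2 ⟨ξ, hξ, ζ, hζ, hne, rfl⟩

theorem lipSeminorm_nonneg (f : LipAlgebra ω) : 0 ≤ lipSeminorm f := by
  refine Real.sSup_nonneg ?_
  rintro _ ⟨ξ, hξ, ζ, hζ, -, rfl⟩
  exact div_nonneg (norm_nonneg _) (ω.nonneg_sphere hξ hζ)

theorem lipSeminorm_le {f : LipAlgebra ω} {a : ℝ} (ha : 0 ≤ a)
    (h : ∀ ξ ∈ sphere (0 : ℂ) 1, ∀ ζ ∈ sphere (0 : ℂ) 1,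
      ‖lipFun f ξ - lipFun f ζ‖ ≤ a * ω ‖ξ - ζ‖) : lipSeminorm f ≤ a := by
  refine Real.sSup_le ?_ ha
  rintro _ ⟨ξ, hξ, ζ, hζ, -, rfl⟩
  exact div_le_of_le_mul₀ (ω.nonneg_sphere hξ hζ) ha (h ξ hξ ζ hζ)

theorem exists_lipFun_eq (ω : ModulusOfContinuity) {F : ℂ → ℂ}
    (hc : ContinuousOn F (closedBall 0 1)) (hd : DifferentiableOn ℂ F (ball 0 1))
    {a : ℝ} (ha : 0 ≤ a)
    (h : ∀ ξ ∈ sphere (0 : ℂ) 1, ∀ ζ ∈ sphere (0 : ℂ) 1, ‖F ξ - F ζ‖ ≤ a * ω ‖ξ - ζ‖) :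
    ∃ f : LipAlgebra ω, ∀ z ∈ closedBall (0 : ℂ) 1, lipFun f z = F z := by
  let k : C(ClosedDisc, ℂ) := ⟨fun z => F z, continuousOn_iff_continuous_domRestrict.1 hc⟩
  have hk : ∀ z ∈ closedBall (0 : ℂ) 1, discExt k z = F z := fun z hz => discExt_of_mem _ hz
  refine ⟨⟨k, hd.congr fun z hz => hk z (ball_subset_closedBall hz), a, ?_⟩, hk⟩
  rintro _ ⟨ξ, hξ, ζ, hζ, -, rfl⟩
  rw [hk _ (sphere_subset_closedBall hξ), hk _ (sphere_subset_closedBall hζ)]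
  exact div_le_of_le_mul₀ (ω.nonneg_sphere hξ hζ) ha (h ξ hξ ζ hζ)

theorem exists_lipFun_eq_id (ω : ModulusOfContinuity) :
    ∃ Z : LipAlgebra ω, ∀ z ∈ closedBall (0 : ℂ) 1, lipFun Z z = z :=
  exists_lipFun_eq ω continuousOn_id differentiableOn_id
    (div_nonneg zero_le_two (ω.pos two_pos le_rfl).le)
    fun _ hξ _ hζ => ω.self_le_mul (norm_nonneg _) (norm_sub_le_two_of_sphere hξ hζ)

theorem isUnit_of_forall_ne_zero {f : LipAlgebra ω}
    (h : ∀ z ∈ closedBall (0 : ℂ) 1, lipFun f z ≠ 0) : IsUnit f := by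
  obtain ⟨z₀, hz₀, hmin⟩ := (isCompact_closedBall (0 : ℂ) 1).exists_isMinOn
    ⟨0, mem_closedBall_self zero_le_one⟩ (continuousOn_lipFun f).norm
  set m := ‖lipFun f z₀‖
  have hm : 0 < m := norm_pos_iff.2 (h z₀ hz₀)
  have hle : ∀ z ∈ sphere (0 : ℂ) 1, m ≤ ‖lipFun f z‖ := fun z hz =>
    hmin (sphere_subset_closedBall hz)
  have hlip : ∀ ξ ∈ sphere (0 : ℂ) 1, ∀ ζ ∈ sphere (0 : ℂ) 1,
      ‖(lipFun f)⁻¹ ξ - (lipFun f)⁻¹ ζ‖ ≤ lipSeminorm f / m ^ 2 * ω ‖ξ - ζ‖ := by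
    intro ξ hξ ζ hζ
    have hnum : 0 ≤ lipSeminorm f * ω ‖ξ - ζ‖ :=
      mul_nonneg (lipSeminorm_nonneg f) (ω.nonneg_sphere hξ hζ)
    calc ‖(lipFun f)⁻¹ ξ - (lipFun f)⁻¹ ζ‖
        = ‖lipFun f ξ - lipFun f ζ‖ / (‖lipFun f ξ‖ * ‖lipFun f ζ‖) := by
          rw [Pi.inv_apply, Pi.inv_apply, inv_sub_inv (h ξ (sphere_subset_closedBall hξ))
            (h ζ (sphere_subset_closedBall hζ)), norm_div, norm_mul, norm_sub_rev]
      _ ≤ lipSeminorm f * ω ‖ξ - ζ‖ / (m * m) := by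
          gcongr
          exacts [norm_lipFun_sub_le f hξ hζ, hle ξ hξ, hle ζ hζ]
      _ = lipSeminorm f / m ^ 2 * ω ‖ξ - ζ‖ := by ring
  obtain ⟨k, hk⟩ := exists_lipFun_eq ω ((continuousOn_lipFun f).inv₀ h)
    ((differentiableOn_lipFun f).inv fun z hz => h z (ball_subset_closedBall hz))
    (div_nonneg (lipSeminorm_nonneg f) (by positivity)) hlip
  refine IsUnit.of_mul_eq_one k (ext_lipFun fun z hz => ?_)
  rw [lipFun_mul, hk z hz, lipFun_one hz, Pi.inv_apply, mul_inv_cancel₀ (h z hz)]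

/-- The inclusion of `Lip_ω` into the disc algebra, used to transfer Gelfand theory from the
Banach algebra `𝒜(𝔻)` to `Lip_ω`. -/
noncomputable def toDiscAlgebra (ω : ModulusOfContinuity) : LipAlgebra ω →ₐ[ℂ] DiscAlgebra :=
  Subalgebra.inclusion fun _ hf => hf.1

theorem denseRange_toDiscAlgebra (ω : ModulusOfContinuity) : DenseRange (toDiscAlgebra ω) := by
  obtain ⟨Z, hZ⟩ := exists_lipFun_eq_id ω
  have hid : toDiscAlgebra ω Z = DiscAlgebra.id :=
    Subtype.ext (ContinuousMap.ext fun z => (discExt_of_mem _ z.2).symm.trans (hZ z z.2))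
  have hle : Algebra.adjoin ℂ {DiscAlgebra.id} ≤ (toDiscAlgebra ω).range :=
    Algebra.adjoin_le (singleton_subset_iff.2 ⟨Z, hid⟩)
  exact DiscAlgebra.dense_adjoin_id.mono hle

theorem map_toDiscAlgebra_subset_closure (J : Ideal (LipAlgebra ω)) :
    (J.map (toDiscAlgebra ω) : Set DiscAlgebra) ⊆ closure (toDiscAlgebra ω '' J) := by
  intro x hx
  induction hx using Submodule.span_induction with
  | mem x hx => exact subset_closure hx
  | zero => exact subset_closure ⟨0, J.zero_mem, map_zero _⟩
  | add x y _ _ hx hy =>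
    refine map_mem_closure₂ continuous_add hx hy ?_
    rintro _ ⟨a, ha, rfl⟩ _ ⟨b, hb, rfl⟩
    exact ⟨a + b, J.add_mem ha hb, map_add _ a b⟩
  | smul a x _ hx =>
    refine map_mem_closure₂ continuous_mul (denseRange_toDiscAlgebra ω a) hx ?_
    rintro _ ⟨b, rfl⟩ _ ⟨f, hf, rfl⟩
    exact ⟨b * f, J.mul_mem_left b hf, map_mul _ b f⟩

theorem exists_forall_mem_lipFun_eq_zero {J : Ideal (LipAlgebra ω)} (hJ : J ≠ ⊤) :
    ∃ w ∈ closedBall (0 : ℂ) 1, ∀ f ∈ J, lipFun f w = 0 := by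
  have hmap : J.map (toDiscAlgebra ω) ≠ ⊤ := by
    intro htop
    have hone : (1 : DiscAlgebra) ∈ closure (toDiscAlgebra ω '' J) :=
      map_toDiscAlgebra_subset_closure J (htop ▸ Submodule.mem_top)
    obtain ⟨_, ⟨f, hf, rfl⟩, hdist⟩ := Metric.mem_closure_iff.1 hone 1 one_pos
    refine hJ (Ideal.eq_top_of_isUnit_mem J hf (isUnit_of_forall_ne_zero fun z hz h0 => ?_))
    have hz1 := (ContinuousMap.dist_lt_iff one_pos).1 hdist ⟨z, hz⟩
    have hfz : f.1 ⟨z, hz⟩ = 0 := (discExt_of_mem _ hz).symm.trans h0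
    change dist (1 : ℂ) (f.1 ⟨z, hz⟩) < 1 at hz1
    rw [hfz, dist_zero_right, norm_one] at hz1
    exact lt_irrefl 1 hz1
  obtain ⟨w, hw⟩ := DiscAlgebra.exists_forall_mem_eval_eq_zero hmap
  exact ⟨w, w.2, fun f hf =>
    (discExt_of_mem _ w.2).trans (hw _ (Ideal.mem_map_of_mem (toDiscAlgebra ω) hf))⟩

theorem mem_of_mul_mem_of_forall_ne_zero {K : Ideal (LipAlgebra ω)} {u v : LipAlgebra ω}
    (huv : u * v ∈ K)
    (h : ∀ w ∈ closedBall (0 : ℂ) 1, (∀ f ∈ K, lipFun f w = 0) → lipFun v w ≠ 0) : u ∈ K := by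
  have htop : K ⊔ Ideal.span {v} = ⊤ := by
    by_contra hne
    obtain ⟨w, hw, h0⟩ := exists_forall_mem_lipFun_eq_zero hne
    exact h w hw (fun f hf => h0 f (Ideal.mem_sup_left hf))
      (h0 v (Ideal.mem_sup_right (Ideal.mem_span_singleton_self v)))
  obtain ⟨k, hk, y, hy, hky⟩ := Submodule.mem_sup.1 ((Ideal.eq_top_iff_one _).1 htop)
  obtain ⟨a, rfl⟩ := Ideal.mem_span_singleton'.1 hy
  have hu : u = u * k + a * (u * v) := by linear_combination (-u) * hky
  rw [hu]
  exact K.add_mem (K.mul_mem_left _ hk) (K.mul_mem_left _ huv)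

end LipAlgebra

/-! ### Herglotz integrals -/

open MeasureTheory Filter Topology

/-- The Herglotz integral `∫ (ξ + z) / (ξ - z) dν(ξ)` of a measure. -/
noncomputable def herglotzIntegral (ν : Measure ℂ) (z : ℂ) : ℂ := ∫ ξ, (ξ + z) / (ξ - z) ∂ν

/-- The zero-free function `exp (- ∫ (ξ + z) / (ξ - z) dν(ξ))`, which is bounded by `1` in the disc;
the outer functions of sup norm at most `1` are of this form, with `dν = - log |f| |dξ| / 2π`. -/
noncomputable def herglotzExp (ν : Measure ℂ) (z : ℂ) : ℂ := Complex.exp (-herglotzIntegral ν z)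

theorem norm_exp_neg_sub_exp_neg_le {a b : ℂ} (ha : 0 ≤ a.re) (hb : 0 ≤ b.re) :
    ‖Complex.exp (-a) - Complex.exp (-b)‖ ≤ ‖a - b‖ := by
  have hderiv : ∀ z ∈ {z : ℂ | 0 ≤ z.re}, HasDerivWithinAt (fun z => Complex.exp (-z))
      (-Complex.exp (-z)) {z : ℂ | 0 ≤ z.re} z := fun z _ => by
    simpa using ((hasDerivAt_neg z).cexp).hasDerivWithinAt
  have hbound : ∀ z ∈ {z : ℂ | 0 ≤ z.re}, ‖-Complex.exp (-z)‖ ≤ 1 := fun z hz => by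
    rw [norm_neg, Complex.norm_exp, Real.exp_le_one_iff]
    simpa using hz
  simpa using (convex_halfSpace_re_ge 0).norm_image_sub_le_of_norm_hasDerivWithin_le
    hderiv hbound hb ha

theorem re_herglotz_kernel {ξ z : ℂ} :
    ((ξ + z) / (ξ - z)).re = (‖ξ‖ ^ 2 - ‖z‖ ^ 2) / ‖ξ - z‖ ^ 2 := by
  simpa [poissonKernel, herglotzRieszKernel] using
    (congrFun (poissonKernel_eq_re_herglotzRieszKernel (c := 0) (w := z)) ξ).symm

theorem measurable_herglotz_kernel (z : ℂ) : Measurable fun ξ : ℂ => (ξ + z) / (ξ - z) := by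
  fun_prop

theorem norm_herglotzExp (ν : Measure ℂ) (z : ℂ) :
    ‖herglotzExp ν z‖ = Real.exp (-(herglotzIntegral ν z).re) := by
  rw [herglotzExp, Complex.norm_exp, Complex.neg_re]

theorem herglotzExp_ne_zero (ν : Measure ℂ) (z : ℂ) : herglotzExp ν z ≠ 0 := Complex.exp_ne_zero _

theorem not_mem_sphere_of_mem_ball {z : ℂ} (hz : z ∈ ball (0 : ℂ) 1) : z ∉ sphere (0 : ℂ) 1 :=
  fun h => (mem_ball.1 hz).ne h

/-- The measure `ν` is carried by the compact subset `S` of the unit circle. -/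
structure IsCarriedBy (ν : Measure ℂ) (S : Set ℂ) : Prop where
  isClosed : IsClosed S
  subset_sphere : S ⊆ sphere 0 1
  ae_mem : ∀ᵐ ξ ∂ν, ξ ∈ S

namespace IsCarriedBy

variable {ν : Measure ℂ} {S : Set ℂ}

theorem isCompact (hν : IsCarriedBy ν S) : IsCompact S :=
  (isCompact_sphere 0 1).of_isClosed_subset hν.isClosed hν.subset_sphere

theorem norm_eq_one (hν : IsCarriedBy ν S) {ξ : ℂ} (hξ : ξ ∈ S) : ‖ξ‖ = 1 :=
  mem_sphere_zero_iff_norm.1 (hν.subset_sphere hξ)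

theorem not_mem_of_mem_ball (hν : IsCarriedBy ν S) {z : ℂ} (hz : z ∈ ball (0 : ℂ) 1) : z ∉ S :=
  fun hzS => not_mem_sphere_of_mem_ball hz (hν.subset_sphere hzS)

theorem continuousOn_herglotz_kernel {z : ℂ} (hz : z ∉ S) :
    ContinuousOn (fun ξ => (ξ + z) / (ξ - z)) S :=
  ContinuousOn.div (by fun_prop) (by fun_prop) fun _ hξ h => hz (sub_eq_zero.1 h ▸ hξ)

theorem ae_poisson_kernel_nonneg (hν : IsCarriedBy ν S) {z : ℂ} (hz : ‖z‖ ≤ 1) :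
    0 ≤ᵐ[ν] fun ξ => (‖ξ‖ ^ 2 - ‖z‖ ^ 2) / ‖ξ - z‖ ^ 2 := by
  filter_upwards [hν.ae_mem] with ξ hξ
  rw [hν.norm_eq_one hξ]
  exact div_nonneg (sub_nonneg.2 (by gcongr)) (by positivity)

variable [IsFiniteMeasure ν]

theorem integrable_herglotz_kernel (hν : IsCarriedBy ν S) {z : ℂ} (hz : z ∉ S) :
    Integrable (fun ξ => (ξ + z) / (ξ - z)) ν := by
  rw [← Measure.restrict_eq_self_of_ae_mem hν.ae_mem]
  exact (continuousOn_herglotz_kernel hz).integrableOn_compact hν.isCompact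

theorem integrable_poisson_kernel (hν : IsCarriedBy ν S) {z : ℂ} (hz : z ∉ S) :
    Integrable (fun ξ => (‖ξ‖ ^ 2 - ‖z‖ ^ 2) / ‖ξ - z‖ ^ 2) ν := by
  simpa only [RCLike.re_to_complex, re_herglotz_kernel] using (hν.integrable_herglotz_kernel hz).re

theorem re_herglotzIntegral (hν : IsCarriedBy ν S) {z : ℂ} (hz : z ∉ S) :
    (herglotzIntegral ν z).re = ∫ ξ, (‖ξ‖ ^ 2 - ‖z‖ ^ 2) / ‖ξ - z‖ ^ 2 ∂ν := by
  simpa only [RCLike.re_to_complex, re_herglotz_kernel, herglotzIntegral] using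
    (integral_re (hν.integrable_herglotz_kernel hz)).symm

theorem re_herglotzIntegral_nonneg (hν : IsCarriedBy ν S) {z : ℂ} (hz : z ∉ S) (hz1 : ‖z‖ ≤ 1) :
    0 ≤ (herglotzIntegral ν z).re := by
  rw [hν.re_herglotzIntegral hz]
  exact integral_nonneg_of_ae (hν.ae_poisson_kernel_nonneg hz1)

theorem re_herglotzIntegral_eq_zero (hν : IsCarriedBy ν S) {z : ℂ} (hz : z ∉ S) (hz1 : ‖z‖ = 1) :
    (herglotzIntegral ν z).re = 0 := by
  rw [hν.re_herglotzIntegral hz]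
  refine integral_eq_zero_of_ae ?_
  filter_upwards [hν.ae_mem] with ξ hξ
  simp [hν.norm_eq_one hξ, hz1]

theorem norm_herglotzExp_le_one (hν : IsCarriedBy ν S) {z : ℂ} (hz : z ∉ S) (hz1 : ‖z‖ ≤ 1) :
    ‖herglotzExp ν z‖ ≤ 1 := by
  rw [norm_herglotzExp, Real.exp_le_one_iff, neg_nonpos]
  exact hν.re_herglotzIntegral_nonneg hz hz1

theorem norm_herglotzExp_eq_one (hν : IsCarriedBy ν S) {z : ℂ} (hz : z ∉ S) (hz1 : ‖z‖ = 1) :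
    ‖herglotzExp ν z‖ = 1 := by
  rw [norm_herglotzExp, hν.re_herglotzIntegral_eq_zero hz hz1, neg_zero, Real.exp_zero]

theorem norm_herglotzExp_lt_one (hν : IsCarriedBy ν S) (hpos : ν ≠ 0) {z : ℂ}
    (hz : z ∈ ball (0 : ℂ) 1) : ‖herglotzExp ν z‖ < 1 := by
  have hzS := hν.not_mem_of_mem_ball hz
  have hz2 : ‖z‖ ^ 2 < 1 := pow_lt_one₀ (norm_nonneg _) (mem_ball_zero_iff.1 hz) two_ne_zero
  have hsupport : Function.support (fun ξ => (‖ξ‖ ^ 2 - ‖z‖ ^ 2) / ‖ξ - z‖ ^ 2) =ᵐ[ν] univ := by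
    refine eventuallyEq_univ.2 ?_
    filter_upwards [hν.ae_mem] with ξ hξ
    have hξz : ξ - z ≠ 0 := fun h => hzS (sub_eq_zero.1 h ▸ hξ)
    rw [Function.mem_support, hν.norm_eq_one hξ, one_pow]
    exact div_ne_zero (sub_pos.2 hz2).ne' (pow_ne_zero 2 (norm_ne_zero_iff.2 hξz))
  rw [norm_herglotzExp, Real.exp_lt_one_iff, neg_lt_zero, hν.re_herglotzIntegral hzS,
    integral_pos_iff_support_of_nonneg_ae
      (hν.ae_poisson_kernel_nonneg (mem_ball_zero_iff.1 hz).le)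
      (hν.integrable_poisson_kernel hzS), measure_congr hsupport]
  exact (Measure.measure_univ_pos).2 hpos

theorem norm_herglotzIntegral_sub_le (hν : IsCarriedBy ν S) {z w : ℂ} (hz : z ∉ S) (hw : w ∉ S)
    {κ : ℝ} (hκ : 0 < κ) (h : ∀ ξ ∈ S, κ ≤ ‖ξ - z‖ * ‖ξ - w‖) :
    ‖herglotzIntegral ν z - herglotzIntegral ν w‖ ≤ 2 * ‖z - w‖ / κ * ν.real univ := by
  rw [herglotzIntegral, herglotzIntegral, ← integral_sub (hν.integrable_herglotz_kernel hz)
    (hν.integrable_herglotz_kernel hw)]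
  refine norm_integral_le_of_norm_le_const ?_
  filter_upwards [hν.ae_mem] with ξ hξ
  have hξz : ξ - z ≠ 0 := fun h0 => hz (sub_eq_zero.1 h0 ▸ hξ)
  have hξw : ξ - w ≠ 0 := fun h0 => hw (sub_eq_zero.1 h0 ▸ hξ)
  calc ‖(ξ + z) / (ξ - z) - (ξ + w) / (ξ - w)‖
      = ‖2 * ξ * (z - w) / ((ξ - z) * (ξ - w))‖ := by congr 1; field_simp; ring
    _ = 2 * ‖z - w‖ / (‖ξ - z‖ * ‖ξ - w‖) := by
        rw [norm_div, norm_mul, norm_mul, norm_mul, hν.norm_eq_one hξ, Complex.norm_ofNat, mul_one]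
    _ ≤ 2 * ‖z - w‖ / κ := by gcongr; exact h ξ hξ

theorem norm_herglotzExp_sub_le (hν : IsCarriedBy ν S) {z w : ℂ} (hz : z ∉ S) (hw : w ∉ S)
    (hz1 : ‖z‖ ≤ 1) (hw1 : ‖w‖ ≤ 1) {κ : ℝ} (hκ : 0 < κ) (h : ∀ ξ ∈ S, κ ≤ ‖ξ - z‖ * ‖ξ - w‖) :
    ‖herglotzExp ν z - herglotzExp ν w‖ ≤ 2 * ‖z - w‖ / κ * ν.real univ :=
  (norm_exp_neg_sub_exp_neg_le (hν.re_herglotzIntegral_nonneg hz hz1)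
    (hν.re_herglotzIntegral_nonneg hw hw1)).trans (hν.norm_herglotzIntegral_sub_le hz hw hκ h)

theorem norm_one_sub_herglotzExp_le (hν : IsCarriedBy ν S) {z : ℂ} (hz : z ∉ S) (hz1 : ‖z‖ ≤ 1)
    {r : ℝ} (hr : 0 < r) (h : ∀ ξ ∈ S, r ≤ ‖ξ - z‖) :
    ‖1 - herglotzExp ν z‖ ≤ 2 / r * ν.real univ := by
  have hexp := norm_exp_neg_sub_exp_neg_le (a := 0) (b := herglotzIntegral ν z) le_rfl
    (hν.re_herglotzIntegral_nonneg hz hz1)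
  rw [neg_zero, Complex.exp_zero, zero_sub, norm_neg] at hexp
  refine hexp.trans (norm_integral_le_of_norm_le_const ?_)
  filter_upwards [hν.ae_mem] with ξ hξ
  rw [norm_div]
  gcongr
  · linarith [norm_add_le ξ z, hν.norm_eq_one hξ]
  · exact h ξ hξ

theorem differentiableAt_herglotzIntegral (hν : IsCarriedBy ν S) {z : ℂ} (hz : z ∉ S) :
    DifferentiableAt ℂ (herglotzIntegral ν) z := by
  obtain ⟨r, hr, hdist⟩ : ∃ r > 0, ∀ w ∈ ball z r, ∀ ξ ∈ S, r ≤ ‖ξ - w‖ := by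
    obtain ⟨r, hr, hball⟩ := Metric.isOpen_iff.1 hν.isClosed.isOpen_compl z hz
    refine ⟨r / 2, half_pos hr, fun w hw ξ hξ => ?_⟩
    by_contra! hlt
    have hξz := dist_triangle ξ w z
    rw [dist_eq_norm ξ w] at hξz
    exact hball (mem_ball.2 (by linarith [mem_ball.1 hw])) hξ
  refine (hasDerivAt_integral_of_dominated_loc_of_deriv_le (μ := ν)
    (F := fun w ξ => (ξ + w) / (ξ - w))
    (F' := fun w ξ => (1 * (ξ - w) - (ξ + w) * (-1)) / (ξ - w) ^ 2)
    (bound := fun _ => 2 / r ^ 2) (ball_mem_nhds z hr)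
    (Eventually.of_forall fun w => (measurable_herglotz_kernel w).aestronglyMeasurable)
    (hν.integrable_herglotz_kernel hz)
    (by fun_prop : Measurable fun ξ : ℂ => _).aestronglyMeasurable ?_
    (integrable_const _) ?_).2.differentiableAt
  · filter_upwards [hν.ae_mem] with ξ hξ w hw
    calc ‖(1 * (ξ - w) - (ξ + w) * (-1)) / (ξ - w) ^ 2‖ = ‖2 * ξ / (ξ - w) ^ 2‖ := by
          congr 2; ring
      _ = 2 / ‖ξ - w‖ ^ 2 := by
          rw [norm_div, norm_mul, norm_pow, hν.norm_eq_one hξ, Complex.norm_ofNat, mul_one]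
      _ ≤ 2 / r ^ 2 := by gcongr; exact hdist w hw ξ hξ
  · filter_upwards [hν.ae_mem] with ξ hξ w hw
    refine HasDerivAt.fun_div ((hasDerivAt_id w).const_add ξ) ((hasDerivAt_id w).const_sub ξ) ?_
    exact norm_pos_iff.1 (hr.trans_le (hdist w hw ξ hξ))

theorem differentiableAt_herglotzExp (hν : IsCarriedBy ν S) {z : ℂ} (hz : z ∉ S) :
    DifferentiableAt ℂ (herglotzExp ν) z :=
  (hν.differentiableAt_herglotzIntegral hz).neg.cexp

end IsCarriedBy

/-- Normalized arc length on the unit circle. -/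
noncomputable def arcMeasure : Measure ℂ :=
  Measure.map (circleMap 0 1)
    (ENNReal.ofReal (2 * Real.pi)⁻¹ • volume.restrict (Ioc 0 (2 * Real.pi)))

instance : IsFiniteMeasure
    (ENNReal.ofReal (2 * Real.pi)⁻¹ • volume.restrict (Ioc 0 (2 * Real.pi))) :=
  Measure.smul_finite _ ENNReal.ofReal_ne_top

instance : IsFiniteMeasure arcMeasure := by unfold arcMeasure; infer_instance

theorem isCarriedBy_arcMeasure : IsCarriedBy arcMeasure (sphere 0 1) :=
  ⟨isClosed_sphere, subset_rfl,
    (ae_map_iff (measurable_circleMap 0 1).aemeasurable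
      (p := fun ξ => ξ ∈ sphere (0 : ℂ) 1) isClosed_sphere.measurableSet).2
      (Eventually.of_forall fun _ => circleMap_mem_sphere _ zero_le_one _)⟩

theorem integral_arcMeasure {E : Type*} [NormedAddCommGroup E] [NormedSpace ℝ E] {F : ℂ → E}
    (hF : AEStronglyMeasurable F arcMeasure) :
    ∫ ξ, F ξ ∂arcMeasure = Real.circleAverage F 0 1 := by
  rw [arcMeasure, integral_map (measurable_circleMap 0 1).aemeasurable hF, integral_smul_measure,
    Real.circleAverage_def, intervalIntegral.integral_of_le Real.two_pi_pos.le,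
    ENNReal.toReal_ofReal (by positivity)]

theorem integrable_arcMeasure {E : Type*} [NormedAddCommGroup E] {F : ℂ → E}
    (hF : AEStronglyMeasurable F arcMeasure) (h : CircleIntegrable F 0 1) :
    Integrable F arcMeasure := by
  rw [arcMeasure, integrable_map_measure hF (measurable_circleMap 0 1).aemeasurable]
  refine Integrable.smul_measure ?_ ENNReal.ofReal_ne_top
  exact (intervalIntegrable_iff_integrableOn_Ioc_of_le Real.two_pi_pos.le).1 h

theorem herglotzIntegral_arcMeasure {z : ℂ} (hz : z ∈ ball (0 : ℂ) 1) :
    herglotzIntegral arcMeasure z = 1 := by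
  have hzs := not_mem_sphere_of_mem_ball hz
  have hcauchy : Real.circleAverage (fun ξ => (ξ / (ξ - z)) • (2 : ℂ)) 0 1 = 2 := by
    have hconst : DiffContOnCl ℂ (fun _ : ℂ => (2 : ℂ)) (ball 0 |1|) := diffContOnCl_const
    simpa only [sub_zero] using hconst.circleAverage_smul_div (by rwa [abs_one])
  have hint : CircleIntegrable (fun ξ => (ξ / (ξ - z)) • (2 : ℂ)) 0 1 := by
    refine ContinuousOn.circleIntegrable zero_le_one (ContinuousOn.fun_smul ?_ continuousOn_const)
    exact continuousOn_id.div (by fun_prop) fun ξ hξ h => hzs (sub_eq_zero.1 h ▸ hξ)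
  have hkernel : EqOn (fun ξ => (ξ + z) / (ξ - z)) (fun ξ => (ξ / (ξ - z)) • (2 : ℂ) - 1)
      (sphere 0 |1|) := fun ξ hξ => by
    rw [abs_one] at hξ
    have hξz : ξ - z ≠ 0 := fun h => hzs (sub_eq_zero.1 h ▸ hξ)
    simp only [smul_eq_mul]
    field_simp
    ring
  rw [herglotzIntegral, integral_arcMeasure (measurable_herglotz_kernel z).aestronglyMeasurable,
    Real.circleAverage_congr_sphere hkernel,
    Real.circleAverage_fun_sub hint (circleIntegrable_const 1 0 1), hcauchy,
    Real.circleAverage_const]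
  norm_num

/-! ### Zero sets of positive length -/

theorem isCarriedBy_restrict (μ : Measure ℂ) {E : Set ℂ} (hE : IsClosed E)
    (hE1 : E ⊆ sphere 0 1) : IsCarriedBy (μ.restrict E) E :=
  ⟨hE, hE1, ae_restrict_mem hE.measurableSet⟩

theorem exp_neg_one_le_norm_herglotzExp_restrict_arcMeasure {E : Set ℂ} (hE : IsClosed E)
    (hE1 : E ⊆ sphere 0 1) {z : ℂ} (hz : z ∈ closedBall (0 : ℂ) 1) (hzE : z ∉ E) :
    Real.exp (-1) ≤ ‖herglotzExp (arcMeasure.restrict E) z‖ := by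
  have hν := isCarriedBy_restrict arcMeasure hE hE1
  rcases (mem_closedBall_zero_iff.1 hz).eq_or_lt with hz1 | hz1
  · rw [hν.norm_herglotzExp_eq_one hzE hz1]
    exact Real.exp_le_one_iff.2 (by norm_num)
  have hzs := not_mem_sphere_of_mem_ball (mem_ball_zero_iff.2 hz1)
  have hone := congrArg Complex.re (herglotzIntegral_arcMeasure (mem_ball_zero_iff.2 hz1))
  rw [isCarriedBy_arcMeasure.re_herglotzIntegral hzs, Complex.one_re] at hone
  rw [norm_herglotzExp, Real.exp_le_exp, neg_le_neg_iff, hν.re_herglotzIntegral hzE, ← hone]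
  exact setIntegral_le_integral (isCarriedBy_arcMeasure.integrable_poisson_kernel hzs)
    (isCarriedBy_arcMeasure.ae_poisson_kernel_nonneg hz1.le)

section MaximumPrinciple

variable {E U : Set ℂ} {h H : ℂ → ℂ}

theorem continuousOn_indicator_compl_div {K : Set ℂ} (hE : IsClosed E) (hc : ContinuousOn h K)
    (h0 : ∀ z ∈ E, h z = 0) (hH : ∀ z ∉ E, ContinuousAt H z) {m : ℝ} (hm : 0 < m)
    (hHm : ∀ z ∈ K, z ∉ E → m ≤ ‖H z‖) :
    ContinuousOn (Eᶜ.indicator fun z => h z / H z) K := by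
  have hbound : ∀ w ∈ K, ‖Eᶜ.indicator (fun z => h z / H z) w‖ ≤ ‖h w‖ / m := fun w hw => by
    by_cases hwE : w ∈ E
    · rw [indicator_of_notMem (not_not.2 hwE), norm_zero]
      positivity
    · rw [indicator_of_mem hwE, norm_div]
      gcongr
      exact hHm w hw hwE
  intro z hz
  by_cases hzE : z ∈ E
  · have hlim : Tendsto (fun w => ‖h w‖ / m) (𝓝[K] z) (𝓝 0) := by
      simpa only [h0 z hzE, norm_zero, zero_div] using Tendsto.div_const (hc z hz).norm m
    rw [ContinuousWithinAt, indicator_of_notMem (not_not.2 hzE)]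
    exact squeeze_zero_norm' (eventually_nhdsWithin_of_forall hbound) hlim
  · have hHz : H z ≠ 0 := norm_pos_iff.1 (hm.trans_le (hHm z hz hzE))
    refine ((hc z hz).div (hH z hzE).continuousWithinAt hHz).congr_of_eventuallyEq ?_
      (indicator_of_mem hzE _)
    filter_upwards [mem_nhdsWithin_of_mem_nhds (hE.isOpen_compl.mem_nhds hzE)] with w hw
    exact indicator_of_mem hw _

theorem norm_le_mul_norm_of_forall_frontier_diff (hE : IsClosed E) (hEU : Disjoint E U)
    (hU : Bornology.IsBounded U) (hd : DiffContOnCl ℂ h U) (h0 : ∀ z ∈ E, h z = 0)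
    (hH : ∀ z ∉ E, DifferentiableAt ℂ H z) {m : ℝ} (hm : 0 < m)
    (hHm : ∀ z ∈ closure U, z ∉ E → m ≤ ‖H z‖) {M : ℝ} (hM : 0 ≤ M)
    (hfr : ∀ z ∈ frontier U, z ∉ E → ‖h z‖ ≤ M * ‖H z‖) {z : ℂ} (hz : z ∈ U) :
    ‖h z‖ ≤ M * ‖H z‖ := by
  have hnotE : ∀ w ∈ U, w ∉ E := fun w hwU hwE => disjoint_left.1 hEU hwE hwU
  have hHpos : ∀ w ∈ closure U, w ∉ E → 0 < ‖H w‖ := fun w hw hwE => hm.trans_le (hHm w hw hwE)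
  have hF : DiffContOnCl ℂ (Eᶜ.indicator fun z => h z / H z) U := by
    refine ⟨(hd.differentiableOn.div
      (fun w hw => (hH w (hnotE w hw)).differentiableWithinAt)
      fun w hw => norm_pos_iff.1 (hHpos w (subset_closure hw) (hnotE w hw))).congr
        fun w hw => indicator_of_mem (hnotE w hw) _, ?_⟩
    exact continuousOn_indicator_compl_div hE hd.continuousOn h0
      (fun w hw => (hH w hw).continuousAt) hm hHm
  have hmax := Complex.norm_le_of_forall_mem_frontier_norm_le hU hF (C := M) (fun w hw => ?_)
    (subset_closure hz)
  · rwa [indicator_of_mem (hnotE z hz), norm_div,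
      div_le_iff₀ (hHpos z (subset_closure hz) (hnotE z hz))] at hmax
  · by_cases hwE : w ∈ E
    · rwa [indicator_of_notMem (not_not.2 hwE), norm_zero]
    · rw [indicator_of_mem hwE, norm_div,
        div_le_iff₀ (hHpos w (frontier_subset_closure hw) hwE)]
      exact hfr w hw hwE

end MaximumPrinciple

-- Compare `h` with the powers of `herglotzExp (arcMeasure.restrict E)`, which have modulus `1` on
-- the circle outside `E` and tend to `0` inside the disc.
theorem eq_zero_of_eqOn_zero_of_arcMeasure_pos {E : Set ℂ} (hE : IsClosed E)
    (hE1 : E ⊆ sphere 0 1) (hpos : 0 < arcMeasure E) {h : ℂ → ℂ} (hd : DiffContOnCl ℂ h (ball 0 1))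
    (h0 : ∀ z ∈ E, h z = 0) {z : ℂ} (hz : z ∈ ball (0 : ℂ) 1) : h z = 0 := by
  let G : ℂ → ℂ := herglotzExp (arcMeasure.restrict E)
  have hν := isCarriedBy_restrict arcMeasure hE hE1
  have hc : ContinuousOn h (closedBall 0 1) := by
    rw [← closure_ball (0 : ℂ) one_ne_zero]
    exact hd.continuousOn
  obtain ⟨M, hM⟩ := (isCompact_closedBall (0 : ℂ) 1).exists_bound_of_continuousOn hc
  have hM0 : 0 ≤ M := (norm_nonneg _).trans (hM 0 (mem_closedBall_self zero_le_one))
  have hle : ∀ n : ℕ, ‖h z‖ ≤ M * ‖G z‖ ^ n := fun n => by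
    rw [← norm_pow]
    refine norm_le_mul_norm_of_forall_frontier_diff (H := fun w => G w ^ n)
      (m := Real.exp (-1) ^ n) hE ?_ isBounded_ball hd h0
      (fun w hw => (hν.differentiableAt_herglotzExp hw).pow n) (by positivity) ?_ hM0 ?_ hz
    · exact disjoint_left.2 fun w hwE hwb => hν.not_mem_of_mem_ball hwb hwE
    · intro w hw hwE
      rw [closure_ball _ one_ne_zero] at hw
      rw [norm_pow]
      gcongr
      exact exp_neg_one_le_norm_herglotzExp_restrict_arcMeasure hE hE1 hw hwE
    · intro w hw hwE
      rw [frontier_ball _ one_ne_zero] at hw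
      rw [norm_pow, hν.norm_herglotzExp_eq_one hwE (mem_sphere_zero_iff_norm.1 hw), one_pow,
        mul_one]
      exact hM w (sphere_subset_closedBall hw)
  have hlt : ‖G z‖ < 1 :=
    hν.norm_herglotzExp_lt_one (by rwa [Ne, Measure.restrict_eq_zero, ← Ne, ← pos_iff_ne_zero]) hz
  have hlim : Tendsto (fun n => M * ‖G z‖ ^ n) atTop (𝓝 0) := by
    simpa only [mul_zero] using
      (tendsto_pow_atTop_nhds_zero_of_lt_one (norm_nonneg _) hlt).const_mul M
  exact norm_le_zero_iff.1 (ge_of_tendsto' hlim hle)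

/-! ### Outer functions -/

theorem IsCarriedBy.of_absolutelyContinuous {μ ν : Measure ℂ} {S : Set ℂ} (hμ : IsCarriedBy μ S)
    (hν : ν ≪ μ) : IsCarriedBy ν S :=
  ⟨hμ.isClosed, hμ.subset_sphere, hν.ae_le hμ.ae_mem⟩

theorem IsCarriedBy.integrable_herglotz_kernel_mul {ν : Measure ℂ} {S : Set ℂ}
    (hν : IsCarriedBy ν S) {F : ℂ → ℂ} (hF : Integrable F ν) {z : ℂ} (hz : z ∉ S) :
    Integrable (fun ξ => (ξ + z) / (ξ - z) * F ξ) ν := by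
  obtain ⟨C, hC⟩ := hν.isCompact.exists_bound_of_continuousOn (continuousOn_herglotz_kernel hz)
  exact hF.bdd_mul (measurable_herglotz_kernel z).aestronglyMeasurable (hν.ae_mem.mono hC)

theorem herglotzIntegral_withDensity_ofReal {μ : Measure ℂ} {U : ℂ → ℝ} (hU : AEMeasurable U μ)
    (hU0 : 0 ≤ᵐ[μ] U) (z : ℂ) :
    herglotzIntegral (μ.withDensity fun ξ => ENNReal.ofReal (U ξ)) z =
      ∫ ξ, (ξ + z) / (ξ - z) * (U ξ : ℂ) ∂μ := by
  rw [herglotzIntegral, integral_withDensity_eq_integral_toReal_smul₀ hU.ennreal_ofReal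
    (Eventually.of_forall fun _ => ENNReal.ofReal_lt_top)]
  refine integral_congr_ae ?_
  filter_upwards [hU0] with ξ hξ
  rw [ENNReal.toReal_ofReal hξ, Complex.real_smul, mul_comm]

namespace LipAlgebra

variable {ω : ModulusOfContinuity}

/-- In the open disc, `f` is `herglotzExp ν` up to a unimodular constant, where `ν` is carried by
the unit circle. -/
structure IsRepresentedBy (f : LipAlgebra ω) (ν : Measure ℂ) : Prop where
  isCarriedBy : IsCarriedBy ν (sphere 0 1)
  exists_eq : ∃ c : ℂ, ‖c‖ = 1 ∧ ∀ z ∈ ball (0 : ℂ) 1, lipFun f z = c * herglotzExp ν z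

namespace IsRepresentedBy

variable {f : LipAlgebra ω} {ν : Measure ℂ}

theorem ne_zero_of_mem_ball (hf : IsRepresentedBy f ν) {z : ℂ} (hz : z ∈ ball (0 : ℂ) 1) :
    lipFun f z ≠ 0 := by
  obtain ⟨c, hc, h⟩ := hf.exists_eq
  rw [h z hz]
  exact mul_ne_zero (norm_ne_zero_iff.1 (hc ▸ one_ne_zero)) (herglotzExp_ne_zero ν z)

end IsRepresentedBy

theorem aemeasurable_log_norm_lipFun (f : LipAlgebra ω) :
    AEMeasurable (fun ξ => Real.log ‖lipFun f ξ‖) arcMeasure := by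
  have hf : AEMeasurable (lipFun f) arcMeasure := by
    rw [← Measure.restrict_eq_self_of_ae_mem isCarriedBy_arcMeasure.ae_mem]
    exact ((continuousOn_lipFun f).mono sphere_subset_closedBall).aemeasurable
      isClosed_sphere.measurableSet
  exact Real.measurable_log.comp_aemeasurable hf.norm

theorem ae_log_norm_lipFun_le (f : LipAlgebra ω) {R : ℝ} (hR : 1 ≤ R) (hfR : supNorm f ≤ R) :
    ∀ᵐ ξ ∂arcMeasure, Real.log ‖lipFun f ξ‖ ≤ Real.log R := by
  filter_upwards [isCarriedBy_arcMeasure.ae_mem] with ξ hξ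
  rcases (norm_nonneg (lipFun f ξ)).eq_or_lt with h0 | h0
  · rw [← h0, Real.log_zero]
    exact Real.log_nonneg hR
  · exact Real.log_le_log h0 ((norm_lipFun_le f (sphere_subset_closedBall hξ)).trans hfR)

theorem IsOuter.exists_isRepresentedBy {f : LipAlgebra ω} (hf : IsOuter f) :
    ∃ a : ℂ, ∃ ν : Measure ℂ, IsFiniteMeasure ν ∧ ν ≪ arcMeasure ∧
      IsRepresentedBy (algebraMap ℂ (LipAlgebra ω) a * f) ν := by
  obtain ⟨hlogc, c, hc, hfc⟩ := hf
  let R := max 1 (supNorm f)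
  let U : ℂ → ℝ := fun ξ => Real.log R - Real.log ‖lipFun f ξ‖
  let ν := arcMeasure.withDensity fun ξ => ENNReal.ofReal (U ξ)
  have hR0 : 0 < R := one_pos.trans_le (le_max_left _ _)
  have hlog : Integrable (fun ξ => Real.log ‖lipFun f ξ‖) arcMeasure :=
    integrable_arcMeasure (aemeasurable_log_norm_lipFun f).aestronglyMeasurable hlogc
  have hU : Integrable U arcMeasure := (integrable_const _).sub hlog
  have hU0 : 0 ≤ᵐ[arcMeasure] U :=
    (ae_log_norm_lipFun_le f (le_max_left _ _) (le_max_right _ _)).mono fun _ => sub_nonneg.2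
  have hν : ν ≪ arcMeasure := withDensity_absolutelyContinuous _ _
  have hintegral : ∀ z ∈ ball (0 : ℂ) 1, herglotzIntegral ν z = Real.log R -
      Real.circleAverage (fun ξ => (ξ + z) / (ξ - z) * (Real.log ‖lipFun f ξ‖ : ℂ)) 0 1 := by
    intro z hz
    have hzs := not_mem_sphere_of_mem_ball hz
    have hkernel : Integrable
        (fun ξ => (ξ + z) / (ξ - z) * (Real.log ‖lipFun f ξ‖ : ℂ)) arcMeasure :=
      isCarriedBy_arcMeasure.integrable_herglotz_kernel_mul hlog.ofReal hzs
    rw [herglotzIntegral_withDensity_ofReal hU.1.aemeasurable hU0, ← integral_arcMeasure hkernel.1]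
    simp only [U, Complex.ofReal_sub, mul_sub]
    rw [integral_sub ((isCarriedBy_arcMeasure.integrable_herglotz_kernel hzs).mul_const _) hkernel,
      integral_mul_const]
    congr 1
    exact (congrArg (· * _) (herglotzIntegral_arcMeasure hz)).trans (one_mul _)
  refine ⟨(R : ℂ)⁻¹, ν, isFiniteMeasure_withDensity_ofReal hU.2, hν,
    isCarriedBy_arcMeasure.of_absolutelyContinuous hν, c, hc, fun z hz => ?_⟩
  rw [lipFun_mul, lipFun_algebraMap _ (ball_subset_closedBall hz), hfc z hz, herglotzExp,
    hintegral z hz, neg_sub, Complex.exp_sub, ← Complex.ofReal_exp, Real.exp_log hR0]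
  ring

end LipAlgebra

/-! ### Covers of the circle by arcs -/

theorem norm_circleMap_sub_circleMap (a b : ℝ) :
    ‖circleMap 0 1 a - circleMap 0 1 b‖ = 2 * |Real.sin ((a - b) / 2)| := by
  have hmul : circleMap 0 1 a - circleMap 0 1 b =
      circleMap 0 1 b * (Complex.exp (Complex.I * (a - b : ℝ)) - 1) := by
    rw [mul_comm Complex.I, mul_sub, mul_one, ← one_mul (Complex.exp _), ← Complex.ofReal_one,
      ← circleMap_zero, circleMap_zero_mul, one_mul, add_sub_cancel]
  rw [hmul, norm_mul, norm_circleMap_zero, abs_one, one_mul,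
    Complex.norm_exp_I_mul_ofReal_sub_one, norm_mul, Real.norm_ofNat, Real.norm_eq_abs]

theorem norm_circleMap_sub_circleMap_le (a b : ℝ) :
    ‖circleMap 0 1 a - circleMap 0 1 b‖ ≤ |a - b| := by
  rw [norm_circleMap_sub_circleMap]
  calc 2 * |Real.sin ((a - b) / 2)| ≤ 2 * |(a - b) / 2| :=
        mul_le_mul_of_nonneg_left Real.abs_sin_le_abs zero_le_two
    _ = |a - b| := by rw [abs_div, abs_two]; ring

theorem norm_circleMap_sub_circleMap_mono {a b a' b' : ℝ} (h : |a - b| ≤ |a' - b'|)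
    (h' : |a' - b'| ≤ Real.pi) :
    ‖circleMap 0 1 a - circleMap 0 1 b‖ ≤ ‖circleMap 0 1 a' - circleMap 0 1 b'‖ := by
  have habs : ∀ x y : ℝ, |(x - y) / 2| = |x - y| / 2 := fun x y => by rw [abs_div, abs_two]
  have hπ := Real.pi_pos
  have h0 := abs_nonneg (a - b)
  rw [norm_circleMap_sub_circleMap, norm_circleMap_sub_circleMap,
    Real.abs_sin_eq_sin_abs_of_abs_le_pi (by rw [habs]; linarith),
    Real.abs_sin_eq_sin_abs_of_abs_le_pi (by rw [habs]; linarith), habs, habs]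
  gcongr
  exact Real.sin_le_sin_of_le_of_le_pi_div_two (by linarith) (by linarith) (by linarith)

theorem exists_circleMap_eq {z : ℂ} (hz : z ∈ sphere (0 : ℂ) 1) :
    ∃ a, |a| ≤ Real.pi ∧ circleMap 0 1 a = z := by
  refine ⟨z.arg, Complex.abs_arg_le_pi z, ?_⟩
  rw [circleMap_zero, ← mem_sphere_zero_iff_norm.1 hz, Complex.norm_mul_exp_arg_mul_I]

theorem exists_circleMap_eq_circleMap_add_eq {ξ ζ : ℂ} (hξ : ξ ∈ sphere (0 : ℂ) 1)
    (hζ : ζ ∈ sphere (0 : ℂ) 1) :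
    ∃ a c, |c| ≤ Real.pi ∧ circleMap 0 1 a = ξ ∧ circleMap 0 1 (a + c) = ζ := by
  rw [mem_sphere_zero_iff_norm] at hξ hζ
  obtain ⟨a, -, rfl⟩ := exists_circleMap_eq (mem_sphere_zero_iff_norm.2 hξ)
  obtain ⟨c, hc, hcζ⟩ := exists_circleMap_eq (z := ζ / circleMap 0 1 a)
    (by rw [mem_sphere_zero_iff_norm, norm_div, hξ, hζ, div_one])
  refine ⟨a, c, hc, rfl, ?_⟩
  rw [← one_mul (1 : ℝ), ← circleMap_zero_mul, hcζ,
    mul_div_cancel₀ _ (circleMap_ne_center one_ne_zero)]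

theorem exists_mem_inter_between {Γ Γ' : Set ℂ} (hΓ : IsClosed Γ) (hΓ' : IsClosed Γ')
    (hcover : Γ ∪ Γ' = sphere 0 1) {ξ ζ : ℂ} (hξ : ξ ∈ Γ) (hζ : ζ ∈ Γ') :
    ∃ p ∈ Γ ∩ Γ', ‖ξ - p‖ ≤ ‖ξ - ζ‖ ∧ ‖ζ - p‖ ≤ ‖ξ - ζ‖ := by
  obtain ⟨a, c, hc, rfl, rfl⟩ := exists_circleMap_eq_circleMap_add_eq
    (hcover.subset (Or.inl hξ)) (hcover.subset (Or.inr hζ))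
  let γ : ℝ → ℂ := fun t => circleMap 0 1 (a + t * c)
  have hγ : Continuous γ := (continuous_circleMap 0 1).comp (by fun_prop)
  have hsub : γ '' Icc 0 1 ⊆ Γ ∪ Γ' := by
    rintro _ ⟨t, -, rfl⟩
    rw [hcover]
    exact circleMap_mem_sphere _ zero_le_one _
  obtain ⟨_, ⟨t, ⟨ht0, ht1⟩, rfl⟩, hp⟩ := isPreconnected_closed_iff.1
    (isPreconnected_Icc.image γ hγ.continuousOn) Γ Γ' hΓ hΓ' hsub
    ⟨_, ⟨0, ⟨le_rfl, zero_le_one⟩, rfl⟩, by simpa only [γ, zero_mul, add_zero] using hξ⟩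
    ⟨_, ⟨1, ⟨zero_le_one, le_rfl⟩, rfl⟩, by simpa only [γ, one_mul] using hζ⟩
  have hac : |a - (a + c)| = |c| := by rw [sub_add_cancel_left, abs_neg]
  refine ⟨_, hp, ?_, ?_⟩ <;> refine norm_circleMap_sub_circleMap_mono ?_ (hac.trans_le hc)
  · rw [hac, sub_add_cancel_left, abs_neg, abs_mul, abs_of_nonneg ht0]
    exact mul_le_of_le_one_left (abs_nonneg c) ht1
  · rw [hac, add_sub_add_left_eq_sub, ← one_sub_mul, abs_mul, abs_of_nonneg (sub_nonneg.2 ht1)]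
    exact mul_le_of_le_one_left (abs_nonneg c) (sub_le_self 1 ht0)

/-- The `j`-th of `M` equal arcs of the unit circle. -/
noncomputable def circleArc (M j : ℕ) : Set ℂ :=
  (fun t : ℝ => circleMap 0 1 (2 * Real.pi / M * t)) '' Icc j (j + 1)

theorem isClosed_circleArc (M j : ℕ) : IsClosed (circleArc M j) :=
  (isCompact_Icc.image ((continuous_circleMap 0 1).comp (by fun_prop))).isClosed

theorem circleArc_subset (M j : ℕ) : circleArc M j ⊆ sphere 0 1 := by
  rintro _ ⟨t, -, rfl⟩
  exact circleMap_mem_sphere _ zero_le_one _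

theorem norm_sub_le_of_mem_circleArc {M j : ℕ} {x y : ℂ} (hx : x ∈ circleArc M j)
    (hy : y ∈ circleArc M j) : ‖x - y‖ ≤ 7 / M := by
  obtain ⟨s, hs, rfl⟩ := hx
  obtain ⟨t, ht, rfl⟩ := hy
  have hst : |s - t| ≤ 1 := abs_le.2 ⟨by linarith [hs.1, ht.2], by linarith [hs.2, ht.1]⟩
  calc ‖circleMap 0 1 (2 * Real.pi / M * s) - circleMap 0 1 (2 * Real.pi / M * t)‖
      ≤ 2 * Real.pi / M * |s - t| := by
        refine (norm_circleMap_sub_circleMap_le _ _).trans_eq ?_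
        rw [← mul_sub, abs_mul, abs_of_nonneg (by positivity)]
    _ ≤ 2 * Real.pi / M * 1 := by gcongr
    _ ≤ 7 / M := by
        rw [mul_one]
        gcongr
        linarith [Real.pi_lt_d2]

theorem exists_mem_circleArc {M : ℕ} (hM : 0 < M) {x : ℂ} (hx : x ∈ sphere (0 : ℂ) 1) :
    ∃ j < M, x ∈ circleArc M j := by
  have hM0 : (0 : ℝ) < M := Nat.cast_pos.2 hM
  have hπ := Real.two_pi_pos
  rw [← abs_one (α := ℝ), ← image_circleMap_Ioc] at hx
  obtain ⟨θ, ⟨hθ0, hθ1⟩, rfl⟩ := hx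
  have ht0 : 0 < M / (2 * Real.pi) * θ := by positivity
  have htM : M / (2 * Real.pi) * θ ≤ M := by
    rw [div_mul_eq_mul_div, div_le_iff₀ hπ]
    gcongr
  obtain ⟨j, hj⟩ := Nat.exists_eq_add_one.2 (Nat.ceil_pos.2 ht0)
  have hle := Nat.le_ceil (M / (2 * Real.pi) * θ)
  have hlt := Nat.ceil_lt_add_one ht0.le
  rw [hj, Nat.cast_add_one] at hle hlt
  refine ⟨j, Nat.lt_of_succ_le (hj.ge.trans (Nat.ceil_le.2 htM)), M / (2 * Real.pi) * θ,
    ⟨by linarith, hle⟩, ?_⟩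
  beta_reduce
  field_simp

theorem pow_eq_one_of_mem_circleArc {M i j : ℕ} (hi : i < M) (hj : j < M) (hij : i ≠ j) {x : ℂ}
    (hxi : x ∈ circleArc M i) (hxj : x ∈ circleArc M j) : x ^ M = 1 := by
  have hM : (M : ℝ) ≠ 0 := Nat.cast_ne_zero.2 (Nat.ne_zero_of_lt hi)
  obtain ⟨s, ⟨his, hsi⟩, rfl⟩ := hxi
  obtain ⟨t, ⟨hjt, htj⟩, hts⟩ := hxj
  obtain ⟨n, hn⟩ := (circleMap_eq_circleMap_iff 0 one_ne_zero).1 hts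
  have hst : t = s + n * M := by
    have hst' : 2 * Real.pi / M * t = 2 * Real.pi / M * s + n * (2 * Real.pi) := by
      refine Complex.ofReal_injective (mul_right_cancel₀ Complex.I_ne_zero ?_)
      rw [hn]
      push_cast
      ring
    field_simp at hst'
    linarith
  obtain ⟨k, rfl⟩ : ∃ k : ℤ, s = k := by
    by_contra! hs
    have hsi' : s ≠ i + 1 := by exact_mod_cast hs (i + 1)
    have hjt' : (j : ℝ) ≠ t := fun h => hs (j - n * M) (by push_cast; linarith)
    have htj' : t ≠ j + 1 := fun h => hs (j + 1 - n * M) (by push_cast; linarith)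
    have his' := lt_of_le_of_ne his (by exact_mod_cast (hs i).symm)
    have hlt : (j : ℝ) < i + n * M + 1 := by
      linarith [lt_of_le_of_ne hjt hjt', lt_of_le_of_ne hsi hsi']
    have hgt : (i : ℝ) + n * M < j + 1 := by linarith [lt_of_le_of_ne htj htj']
    have hji : (j : ℤ) = i + n * M := by
      have hlt' : (j : ℤ) < i + n * M + 1 := by exact_mod_cast hlt
      have hgt' : (i : ℤ) + n * M < j + 1 := by exact_mod_cast hgt
      omega
    have hmod : j ≡ i [MOD M] := (Int.natCast_modEq_iff).1 (by simp [hji, Int.ModEq])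
    exact hij (hmod.eq_of_lt_of_lt hj hi).symm
  have hk := (periodic_circleMap 0 1).int_mul_eq k
  have hone : circleMap 0 1 0 = 1 := by simp [circleMap_zero]
  rw [hone] at hk
  rw [circleMap_zero_pow, one_pow, ← hk]
  field_simp

/-- Two closed sets which cover the unit circle and intersect in a finite set `S`. -/
structure CircleCover where
  Γ : Set ℂ
  Γ' : Set ℂ
  S : Finset ℂ
  isClosed : IsClosed Γ
  isClosed' : IsClosed Γ'
  union_eq : Γ ∪ Γ' = sphere 0 1
  mem_S_iff : ∀ {z}, z ∈ S ↔ z ∈ Γ ∧ z ∈ Γ'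

/-- The union of those among the `M` equal arcs whose index satisfies `p`. -/
def circleArcs (M : ℕ) (p : ℕ → Prop) : Set ℂ := {x | ∃ j < M, p j ∧ x ∈ circleArc M j}

theorem isClosed_circleArcs (M : ℕ) (p : ℕ → Prop) : IsClosed (circleArcs M p) := by
  have hunion : circleArcs M p = ⋃ j ∈ {j | j < M ∧ p j}, circleArc M j := by
    ext x
    simp [circleArcs, and_assoc]
  rw [hunion]
  exact ((finite_lt_nat M).subset fun j hj => hj.1).isClosed_biUnion
    fun j _ => isClosed_circleArc M j

theorem circleArcs_union_compl {M : ℕ} (hM : 0 < M) (p : ℕ → Prop) :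
    circleArcs M p ∪ circleArcs M (fun j => ¬p j) = sphere 0 1 := by
  refine Subset.antisymm ?_ fun x hx => ?_
  · rintro x (⟨j, -, -, hxj⟩ | ⟨j, -, -, hxj⟩) <;> exact circleArc_subset M j hxj
  · obtain ⟨j, hj, hxj⟩ := exists_mem_circleArc hM hx
    by_cases hp : p j
    exacts [Or.inl ⟨j, hj, hp, hxj⟩, Or.inr ⟨j, hj, hp, hxj⟩]

open Classical in
/-- The cover of the circle by the arcs whose index satisfies `p` and the remaining ones. -/
noncomputable def arcCover {M : ℕ} (hM : 0 < M) (p : ℕ → Prop) : CircleCover where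
  Γ := circleArcs M p
  Γ' := circleArcs M fun j => ¬p j
  S := {x ∈ Polynomial.nthRootsFinset M (1 : ℂ) |
    x ∈ circleArcs M p ∧ x ∈ circleArcs M fun j => ¬p j}
  isClosed := isClosed_circleArcs M p
  isClosed' := isClosed_circleArcs M _
  union_eq := circleArcs_union_compl hM p
  mem_S_iff := by
    refine ⟨fun h => (Finset.mem_filter.1 h).2, fun h => Finset.mem_filter.2 ⟨?_, h⟩⟩
    obtain ⟨⟨i, hi, hpi, hxi⟩, j, hj, hpj, hxj⟩ := h
    rw [Polynomial.mem_nthRootsFinset hM]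
    exact pow_eq_one_of_mem_circleArc hi hj (fun hij => hpj (hij ▸ hpi)) hxi hxj

theorem card_arcCover_le {M : ℕ} (hM : 0 < M) (p : ℕ → Prop) : (arcCover hM p).S.card ≤ M := by
  classical
  exact (Finset.card_filter_le _ _).trans
    ((Multiset.toFinset_card_le _).trans (Polynomial.card_nthRoots M 1))

theorem exists_circleCover_near (E : Set ℂ) {M : ℕ} (hM : 0 < M) :
    ∃ P : CircleCover, P.S.card ≤ M ∧ (∀ x ∈ P.Γ', ∀ e ∈ E, 1 / (M : ℝ) < ‖x - e‖) ∧
      ∀ x ∈ P.Γ, ∃ e ∈ E, ‖x - e‖ ≤ 8 / M := by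
  refine ⟨arcCover hM fun j => ∃ y ∈ circleArc M j, ∃ e ∈ E, ‖y - e‖ ≤ 1 / (M : ℝ),
    card_arcCover_le hM _, ?_, ?_⟩
  · rintro x ⟨j, -, hfar, hxj⟩ e he
    by_contra! hle
    exact hfar ⟨x, hxj, e, he, hle⟩
  · rintro x ⟨j, -, ⟨y, hyj, e, he, hye⟩, hxj⟩
    refine ⟨e, he, ?_⟩
    calc ‖x - e‖ ≤ ‖x - y‖ + ‖y - e‖ := norm_sub_le_norm_sub_add_norm_sub x y e
      _ ≤ 7 / M + 1 / M := add_le_add (norm_sub_le_of_mem_circleArc hxj hyj) hye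
      _ = 8 / M := by ring

/-! ### Rational functions with prescribed zeros on the circle -/

theorem norm_prod_sub_prod_le {ι : Type*} (s : Finset ι) {u v : ι → ℂ}
    (hu : ∀ i ∈ s, ‖u i‖ ≤ 1) (hv : ∀ i ∈ s, ‖v i‖ ≤ 1) :
    ‖∏ i ∈ s, u i - ∏ i ∈ s, v i‖ ≤ ∑ i ∈ s, ‖u i - v i‖ := by
  classical
  induction s using Finset.induction_on with
  | empty => simp
  | insert a s ha ih =>
    rw [Finset.prod_insert ha, Finset.prod_insert ha, Finset.sum_insert ha]
    have hs : ‖∏ i ∈ s, v i‖ ≤ 1 := by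
      rw [norm_prod]
      exact Finset.prod_le_one (fun _ _ => norm_nonneg _)
        fun i hi => hv i (Finset.mem_insert_of_mem hi)
    have hsub := ih (fun i hi => hu i (Finset.mem_insert_of_mem hi))
      fun i hi => hv i (Finset.mem_insert_of_mem hi)
    have hsplit : u a * ∏ i ∈ s, u i - v a * ∏ i ∈ s, v i
        = u a * (∏ i ∈ s, u i - ∏ i ∈ s, v i) + (u a - v a) * ∏ i ∈ s, v i := by ring
    rw [hsplit]
    refine (norm_add_le _ _).trans ?_
    rw [norm_mul, norm_mul, add_comm]
    exact add_le_add (mul_le_of_le_one_right (norm_nonneg _) hs)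
      ((mul_le_of_le_one_left (norm_nonneg _) (hu a (Finset.mem_insert_self a s))).trans hsub)

/-- A product of factors `(z - p) / (z - (1 + ε) p)`, which vanishes at the points `p ∈ S` of the
circle and is close to `1` away from them. -/
noncomputable def zeroFactor (S : Finset ℂ) (ε : ℝ) (z : ℂ) : ℂ :=
  ∏ p ∈ S, (z - p) / (z - (1 + ε) * p)

section ZeroFactor

variable {S : Finset ℂ} {ε : ℝ} {p z w : ℂ}

theorem norm_sub_le_norm_sub_one_add_mul (hp : ‖p‖ = 1) (hε : 0 ≤ ε) (hz : ‖z‖ ≤ 1) :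
    ‖z - p‖ ≤ ‖z - (1 + ε) * p‖ := by
  refine (sq_le_sq₀ (norm_nonneg _) (norm_nonneg _)).1 ?_
  have hsplit : z - (1 + ε) * p = (z - p) - (ε : ℝ) • p := by
    rw [Complex.real_smul]
    ring
  have hinner : inner ℝ z p ≤ 1 := (real_inner_le_norm z p).trans (by rwa [hp, mul_one])
  rw [hsplit, norm_sub_sq_real (z - p), inner_smul_right, inner_sub_left,
    real_inner_self_eq_norm_sq, hp]
  linarith [mul_nonneg hε (sub_nonneg.2 hinner), sq_nonneg ‖ε • p‖]

theorem le_norm_sub_one_add_mul (hp : ‖p‖ = 1) (hε : 0 ≤ ε) (hz : ‖z‖ ≤ 1) :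
    ε ≤ ‖z - (1 + ε) * p‖ := by
  have htri := norm_sub_norm_le ((1 + ε) * p) z
  have hnorm : ‖(1 + ε : ℂ)‖ = 1 + ε := by
    rw [← Complex.ofReal_one, ← Complex.ofReal_add, Complex.norm_of_nonneg (by linarith)]
  rw [norm_mul, hp, mul_one, norm_sub_rev, hnorm] at htri
  linarith

theorem sub_one_add_mul_ne_zero (hp : ‖p‖ = 1) (hε : 0 < ε) (hz : ‖z‖ ≤ 1) :
    z - (1 + ε) * p ≠ 0 :=
  norm_pos_iff.1 (hε.trans_le (le_norm_sub_one_add_mul hp hε.le hz))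

theorem norm_sub_div_sub_one_add_mul_le_one (hp : ‖p‖ = 1) (hε : 0 < ε) (hz : ‖z‖ ≤ 1) :
    ‖(z - p) / (z - (1 + ε) * p)‖ ≤ 1 := by
  rw [norm_div]
  exact div_le_one_of_le₀ (norm_sub_le_norm_sub_one_add_mul hp hε.le hz) (norm_nonneg _)

theorem norm_zeroFactor_le_one (hS : ∀ p ∈ S, ‖p‖ = 1) (hε : 0 < ε) (hz : ‖z‖ ≤ 1) :
    ‖zeroFactor S ε z‖ ≤ 1 := by
  rw [zeroFactor, norm_prod]
  exact Finset.prod_le_one (fun _ _ => norm_nonneg _)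
    fun p hp => norm_sub_div_sub_one_add_mul_le_one (hS p hp) hε hz

theorem norm_zeroFactor_sub_le (hS : ∀ p ∈ S, ‖p‖ = 1) (hε : 0 < ε) (hz : ‖z‖ ≤ 1)
    (hw : ‖w‖ ≤ 1) {κ : ℝ} (hκ : 0 < κ)
    (h : ∀ p ∈ S, κ ≤ ‖z - (1 + ε) * p‖ * ‖w - (1 + ε) * p‖) :
    ‖zeroFactor S ε z - zeroFactor S ε w‖ ≤ S.card * ε * ‖z - w‖ / κ := by
  refine (norm_prod_sub_prod_le S (fun p hp => norm_sub_div_sub_one_add_mul_le_one (hS p hp) hε hz)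
    fun p hp => norm_sub_div_sub_one_add_mul_le_one (hS p hp) hε hw).trans ?_
  rw [mul_assoc, mul_div_assoc, ← nsmul_eq_mul]
  refine Finset.sum_le_card_nsmul S _ _ fun p hp => ?_
  have hz0 := sub_one_add_mul_ne_zero (hS p hp) hε hz
  have hw0 := sub_one_add_mul_ne_zero (hS p hp) hε hw
  have hfactor : (z - p) / (z - (1 + ε) * p) - (w - p) / (w - (1 + ε) * p)
      = ε * p * (w - z) / ((z - (1 + ε) * p) * (w - (1 + ε) * p)) := by
    rw [div_sub_div _ _ hz0 hw0]
    congr 1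
    ring
  rw [hfactor, norm_div, norm_mul, norm_mul, norm_mul, hS p hp, mul_one,
    Complex.norm_of_nonneg hε.le, norm_sub_rev]
  gcongr
  exact h p hp

theorem norm_zeroFactor_sub_le_div (hS : ∀ p ∈ S, ‖p‖ = 1) (hε : 0 < ε) (hz : ‖z‖ ≤ 1)
    (hw : ‖w‖ ≤ 1) : ‖zeroFactor S ε z - zeroFactor S ε w‖ ≤ S.card / ε * ‖z - w‖ := by
  refine (norm_zeroFactor_sub_le hS hε hz hw (mul_pos hε hε) fun p hp => ?_).trans_eq ?_
  · exact mul_le_mul (le_norm_sub_one_add_mul (hS p hp) hε.le hz)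
      (le_norm_sub_one_add_mul (hS p hp) hε.le hw) hε.le (norm_nonneg _)
  · field_simp

theorem norm_one_sub_zeroFactor_le (hS : ∀ p ∈ S, ‖p‖ = 1) (hε : 0 < ε) (hz : ‖z‖ ≤ 1) {r : ℝ}
    (hr : 0 < r) (h : ∀ p ∈ S, r ≤ ‖p - z‖) : ‖1 - zeroFactor S ε z‖ ≤ S.card * ε / r := by
  have hprod := norm_prod_sub_prod_le S (u := fun _ => (1 : ℂ)) (fun _ _ => norm_one.le)
    fun p hp => norm_sub_div_sub_one_add_mul_le_one (hS p hp) hε hz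
  rw [Finset.prod_const_one] at hprod
  refine hprod.trans ?_
  rw [mul_div_assoc, ← nsmul_eq_mul]
  refine Finset.sum_le_card_nsmul S _ _ fun p hp => ?_
  have hfactor : 1 - (z - p) / (z - (1 + ε) * p) = -(ε * p) / (z - (1 + ε) * p) := by
    rw [one_sub_div (sub_one_add_mul_ne_zero (hS p hp) hε hz)]
    congr 1
    ring
  rw [hfactor, norm_div, norm_neg, norm_mul, hS p hp, mul_one, Complex.norm_of_nonneg hε.le]
  gcongr
  exact (norm_sub_rev z p ▸ h p hp).trans
    (norm_sub_le_norm_sub_one_add_mul (hS p hp) hε.le hz)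

theorem zeroFactor_ne_zero (hS : ∀ p ∈ S, ‖p‖ = 1) (hε : 0 < ε) (hz : ‖z‖ ≤ 1) (hzS : z ∉ S) :
    zeroFactor S ε z ≠ 0 := by
  rw [zeroFactor, Finset.prod_ne_zero_iff]
  intro p hp
  refine div_ne_zero (fun h => hzS ?_) (sub_one_add_mul_ne_zero (hS p hp) hε hz)
  rwa [sub_eq_zero.1 h]

theorem differentiableAt_zeroFactor (hS : ∀ p ∈ S, ‖p‖ = 1) (hε : 0 < ε) (hz : ‖z‖ ≤ 1) :
    DifferentiableAt ℂ (zeroFactor S ε) z := by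
  unfold zeroFactor
  refine DifferentiableAt.fun_finsetProd fun p hp => ?_
  exact DifferentiableAt.fun_div (by fun_prop) (by fun_prop)
    (sub_one_add_mul_ne_zero (hS p hp) hε hz)

theorem zeroFactor_eq_zero (hz : z ∈ S) : zeroFactor S ε z = 0 :=
  Finset.prod_eq_zero hz (by rw [sub_self, zero_div])

end ZeroFactor

/-! ### Splitting an outer function -/

namespace CircleCover

variable (P : CircleCover)

/-- The cover with its two members interchanged. -/
def symm : CircleCover where
  Γ := P.Γ'
  Γ' := P.Γ
  S := P.S
  isClosed := P.isClosed'
  isClosed' := P.isClosed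
  union_eq := by rw [union_comm, P.union_eq]
  mem_S_iff := P.mem_S_iff.trans and_comm

theorem subset_sphere : P.Γ ⊆ sphere 0 1 := P.union_eq ▸ subset_union_left

theorem norm_eq_one_of_mem_S {p : ℂ} (hp : p ∈ P.S) : ‖p‖ = 1 :=
  mem_sphere_zero_iff_norm.1 (P.subset_sphere (P.mem_S_iff.1 hp).1)

theorem mem_or_mem {z : ℂ} (hz : z ∈ sphere (0 : ℂ) 1) : z ∈ P.Γ ∨ z ∈ P.Γ' := by
  rwa [← P.union_eq] at hz

theorem not_mem_S {z : ℂ} (h : z ∉ P.Γ) : z ∉ P.S := fun hS => h (P.mem_S_iff.1 hS).1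

theorem mem_ball_of_not_mem {z : ℂ} (hz : z ∈ closedBall (0 : ℂ) 1) (h : z ∉ P.Γ)
    (h' : z ∉ P.Γ') : z ∈ ball (0 : ℂ) 1 := by
  rw [← ball_union_sphere] at hz
  exact hz.resolve_right fun hzs => (P.mem_or_mem hzs).elim h h'

variable {P} {ε Λ : ℝ} {z w ξ ζ : ℂ}

theorem norm_zeroFactor_le_one (hε : 0 < ε) (hz : z ∈ closedBall (0 : ℂ) 1) :
    ‖zeroFactor P.S ε z‖ ≤ 1 :=
  _root_.norm_zeroFactor_le_one (fun _ => P.norm_eq_one_of_mem_S) hε (mem_closedBall_zero_iff.1 hz)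

theorem differentiableAt_zeroFactor (hε : 0 < ε) (hz : z ∈ closedBall (0 : ℂ) 1) :
    DifferentiableAt ℂ (zeroFactor P.S ε) z :=
  _root_.differentiableAt_zeroFactor (fun _ => P.norm_eq_one_of_mem_S) hε
    (mem_closedBall_zero_iff.1 hz)

theorem norm_zeroFactor_sub_le_mul (hε : 0 < ε) (hΛ : P.S.card / ε ≤ Λ)
    (hz : z ∈ closedBall (0 : ℂ) 1) (hw : w ∈ closedBall (0 : ℂ) 1) :
    ‖zeroFactor P.S ε z - zeroFactor P.S ε w‖ ≤ Λ * ‖z - w‖ :=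
  (norm_zeroFactor_sub_le_div (fun _ => P.norm_eq_one_of_mem_S) hε (mem_closedBall_zero_iff.1 hz)
    (mem_closedBall_zero_iff.1 hw)).trans (by gcongr)

theorem norm_zeroFactor_le_mul (hε : 0 < ε) (hΛ : P.S.card / ε ≤ Λ) (hξ : ξ ∈ P.Γ)
    (hζ : ζ ∈ P.Γ') :
    ‖zeroFactor P.S ε ξ‖ ≤ Λ * ‖ξ - ζ‖ ∧ ‖zeroFactor P.S ε ζ‖ ≤ Λ * ‖ξ - ζ‖ := by
  have hΛ0 : 0 ≤ Λ := le_trans (by positivity) hΛ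
  obtain ⟨p, hp, hξp, hζp⟩ := exists_mem_inter_between P.isClosed P.isClosed' P.union_eq hξ hζ
  have hpS : p ∈ P.S := P.mem_S_iff.2 hp
  have hle : ∀ x ∈ sphere (0 : ℂ) 1, ‖x - p‖ ≤ ‖ξ - ζ‖ →
      ‖zeroFactor P.S ε x‖ ≤ Λ * ‖ξ - ζ‖ := by
    intro x hx hxp
    have hsub := norm_zeroFactor_sub_le_mul hε hΛ (sphere_subset_closedBall hx)
      (sphere_subset_closedBall (P.subset_sphere hp.1))
    rw [zeroFactor_eq_zero hpS, sub_zero] at hsub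
    exact hsub.trans (by gcongr)
  exact ⟨hle ξ (P.subset_sphere hξ) hξp, hle ζ (P.symm.subset_sphere hζ) hζp⟩

theorem norm_zeroFactor_mul_herglotzExp_sub_le {ν : Measure ℂ} [IsFiniteMeasure ν]
    (hν : IsCarriedBy ν P.Γ) (hε : 0 < ε) (hΛ : P.S.card / ε ≤ Λ) (hΛ0 : 0 < Λ)
    (hξ1 : ξ ∈ sphere (0 : ℂ) 1) (hζ1 : ζ ∈ sphere (0 : ℂ) 1) (hξ : ξ ∉ P.Γ) (hζ : ζ ∉ P.Γ) :
    ‖zeroFactor P.S ε ξ‖ * ‖zeroFactor P.S ε ζ‖ * ‖herglotzExp ν ξ - herglotzExp ν ζ‖ ≤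
      2 * ν.real univ * Λ ^ 2 * ‖ξ - ζ‖ := by
  set κ := ‖zeroFactor P.S ε ξ‖ * ‖zeroFactor P.S ε ζ‖ with hκ
  rcases (by positivity : 0 ≤ κ).eq_or_lt with hκ0 | hκ0
  · rw [← hκ0, zero_mul]
    positivity
  · have hκle : ∀ γ ∈ P.Γ, κ / Λ ^ 2 ≤ ‖γ - ξ‖ * ‖γ - ζ‖ := fun γ hγ => by
      have hbξ := (norm_zeroFactor_le_mul hε hΛ hγ ((P.mem_or_mem hξ1).resolve_left hξ)).2
      have hbζ := (norm_zeroFactor_le_mul hε hΛ hγ ((P.mem_or_mem hζ1).resolve_left hζ)).2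
      rw [div_le_iff₀ (by positivity)]
      calc κ ≤ (Λ * ‖γ - ξ‖) * (Λ * ‖γ - ζ‖) := by rw [hκ]; gcongr
        _ = _ := by ring
    calc κ * ‖herglotzExp ν ξ - herglotzExp ν ζ‖
        ≤ κ * (2 * ‖ξ - ζ‖ / (κ / Λ ^ 2) * ν.real univ) := by
          gcongr
          exact hν.norm_herglotzExp_sub_le hξ hζ (mem_sphere_zero_iff_norm.1 hξ1).le
            (mem_sphere_zero_iff_norm.1 hζ1).le (by positivity) hκle
      _ = _ := by field_simp

end CircleCover

namespace LipAlgebra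

variable {ω : ModulusOfContinuity}

/-- A splitting of `f` into a product of two zero-free functions, whose representing measures live
on the two members of a cover of the circle. -/
structure OuterSplitting (f : LipAlgebra ω) extends CircleCover where
  ν : Measure ℂ
  ν' : Measure ℂ
  c : ℂ
  isFiniteMeasure : IsFiniteMeasure ν
  isFiniteMeasure' : IsFiniteMeasure ν'
  isCarriedBy : IsCarriedBy ν Γ
  isCarriedBy' : IsCarriedBy ν' Γ'
  norm_c : ‖c‖ = 1
  eq_mul : ∀ z ∈ ball (0 : ℂ) 1, lipFun f z = c * (herglotzExp ν z * herglotzExp ν' z)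

namespace OuterSplitting

attribute [instance] isFiniteMeasure isFiniteMeasure'

variable {f : LipAlgebra ω} (P : OuterSplitting f)

/-- The splitting with the two factors interchanged. -/
def symm : OuterSplitting f where
  toCircleCover := P.toCircleCover.symm
  ν := P.ν'
  ν' := P.ν
  c := P.c
  isFiniteMeasure := P.isFiniteMeasure'
  isFiniteMeasure' := P.isFiniteMeasure
  isCarriedBy := P.isCarriedBy'
  isCarriedBy' := P.isCarriedBy
  norm_c := P.norm_c
  eq_mul z hz := by rw [P.eq_mul z hz, mul_comm (herglotzExp P.ν z)]

theorem c_ne_zero : P.c ≠ 0 := norm_ne_zero_iff.1 (P.norm_c ▸ one_ne_zero)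

theorem norm_lipFun_le_one (P : OuterSplitting f) {z : ℂ} (hz : z ∈ closedBall (0 : ℂ) 1) :
    ‖lipFun f z‖ ≤ 1 := by
  refine (norm_lipFun_le f hz).trans (supNorm_le fun w hw => ?_)
  have hw1 := (mem_ball_zero_iff.1 hw).le
  rw [P.eq_mul w hw, norm_mul, P.norm_c, one_mul, norm_mul]
  exact mul_le_one₀
    (P.isCarriedBy.norm_herglotzExp_le_one (P.isCarriedBy.not_mem_of_mem_ball hw) hw1)
    (norm_nonneg _)
    (P.isCarriedBy'.norm_herglotzExp_le_one (P.isCarriedBy'.not_mem_of_mem_ball hw) hw1)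

open Classical in
/-- The factor of `f` which belongs to `Γ`, on the closed disc. The first formula continues the
second one, which is valid in the open disc only, to the points of `Γ` outside of `Γ'`. -/
noncomputable def factor (z : ℂ) : ℂ :=
  if z ∈ P.Γ then lipFun f z / (P.c * herglotzExp P.ν' z) else herglotzExp P.ν z

theorem factor_of_not_mem {z : ℂ} (h : z ∉ P.Γ) : P.factor z = herglotzExp P.ν z := if_neg h

theorem factor_of_not_mem' {z : ℂ} (hz : z ∈ closedBall (0 : ℂ) 1) (h : z ∉ P.Γ') :
    P.factor z = lipFun f z / (P.c * herglotzExp P.ν' z) := by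
  by_cases hΓ : z ∈ P.Γ
  · exact if_pos hΓ
  · rw [P.factor_of_not_mem hΓ, P.eq_mul z (P.mem_ball_of_not_mem hz hΓ h), mul_left_comm,
      mul_div_cancel_right₀ _ (mul_ne_zero P.c_ne_zero (herglotzExp_ne_zero P.ν' z))]

theorem norm_factor_le_one {z : ℂ} (hz : z ∈ closedBall (0 : ℂ) 1) (hS : z ∉ P.S) :
    ‖P.factor z‖ ≤ 1 := by
  by_cases hΓ : z ∈ P.Γ
  · have hΓ' : z ∉ P.Γ' := fun h' => hS (P.mem_S_iff.2 ⟨hΓ, h'⟩)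
    rw [P.factor_of_not_mem' hz hΓ', norm_div, norm_mul, P.norm_c,
      P.isCarriedBy'.norm_herglotzExp_eq_one hΓ' (P.isCarriedBy.norm_eq_one hΓ), one_mul, div_one]
    exact P.norm_lipFun_le_one hz
  · rw [P.factor_of_not_mem hΓ]
    exact P.isCarriedBy.norm_herglotzExp_le_one hΓ (mem_closedBall_zero_iff.1 hz)

theorem norm_factor_sub_le {ξ ζ : ℂ} (hξ : ξ ∈ sphere (0 : ℂ) 1) (hζ : ζ ∈ sphere (0 : ℂ) 1)
    (hξΓ' : ξ ∉ P.Γ') (hζΓ' : ζ ∉ P.Γ') :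
    ‖P.factor ξ - P.factor ζ‖ ≤
      lipSeminorm f * ω ‖ξ - ζ‖ + ‖herglotzExp P.ν' ξ - herglotzExp P.ν' ζ‖ := by
  have hc := P.c_ne_zero
  have hξ0 := herglotzExp_ne_zero P.ν' ξ
  have hζ0 := herglotzExp_ne_zero P.ν' ζ
  have hξ1 := P.isCarriedBy'.norm_herglotzExp_eq_one hξΓ' (mem_sphere_zero_iff_norm.1 hξ)
  have hζ1 := P.isCarriedBy'.norm_herglotzExp_eq_one hζΓ' (mem_sphere_zero_iff_norm.1 hζ)
  have hsplit : P.factor ξ - P.factor ζ = ((lipFun f ξ - lipFun f ζ) / herglotzExp P.ν' ξ -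
      lipFun f ζ * (herglotzExp P.ν' ξ - herglotzExp P.ν' ζ) /
        (herglotzExp P.ν' ξ * herglotzExp P.ν' ζ)) / P.c := by
    rw [P.factor_of_not_mem' (sphere_subset_closedBall hξ) hξΓ',
      P.factor_of_not_mem' (sphere_subset_closedBall hζ) hζΓ']
    field_simp
    ring
  rw [hsplit, norm_div, P.norm_c, div_one]
  refine (_root_.norm_sub_le _ _).trans (add_le_add ?_ ?_)
  · rw [norm_div, hξ1, div_one]
    exact norm_lipFun_sub_le f hξ hζ
  · rw [norm_div, norm_mul, norm_mul, hξ1, hζ1, mul_one, div_one]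
    exact mul_le_of_le_one_left (norm_nonneg _)
      (P.norm_lipFun_le_one (sphere_subset_closedBall hζ))

/-- The factor of `f` which belongs to `Γ`, made continuous on the closed disc by zeros at the
common points of `Γ` and `Γ'`. -/
noncomputable def dampedFactor (ε : ℝ) (z : ℂ) : ℂ := zeroFactor P.S ε z ^ 2 * P.factor z

variable {ε : ℝ}

theorem norm_dampedFactor_le (ε : ℝ) {z : ℂ} (hz : z ∈ closedBall (0 : ℂ) 1) :
    ‖P.dampedFactor ε z‖ ≤ ‖zeroFactor P.S ε z‖ ^ 2 := by
  rw [dampedFactor, norm_mul, norm_pow]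
  by_cases hS : z ∈ P.S
  · simp [zeroFactor_eq_zero hS]
  · exact mul_le_of_le_one_right (by positivity) (P.norm_factor_le_one hz hS)

theorem norm_dampedFactor_le_norm_zeroFactor (hε : 0 < ε) {z : ℂ}
    (hz : z ∈ closedBall (0 : ℂ) 1) : ‖P.dampedFactor ε z‖ ≤ ‖zeroFactor P.S ε z‖ :=
  (P.norm_dampedFactor_le ε hz).trans
    (pow_le_of_le_one (norm_nonneg _) (P.norm_zeroFactor_le_one hε hz) two_ne_zero)

theorem norm_dampedFactor_le_one (hε : 0 < ε) {z : ℂ} (hz : z ∈ closedBall (0 : ℂ) 1) :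
    ‖P.dampedFactor ε z‖ ≤ 1 :=
  (P.norm_dampedFactor_le_norm_zeroFactor hε hz).trans (P.norm_zeroFactor_le_one hε hz)

theorem dampedFactor_ne_zero (hε : 0 < ε) {z : ℂ} (hz : z ∈ closedBall (0 : ℂ) 1) (h : z ∉ P.Γ) :
    P.dampedFactor ε z ≠ 0 := by
  rw [dampedFactor, P.factor_of_not_mem h]
  exact mul_ne_zero (pow_ne_zero 2 (zeroFactor_ne_zero (fun _ => P.norm_eq_one_of_mem_S) hε
    (mem_closedBall_zero_iff.1 hz) (P.not_mem_S h))) (herglotzExp_ne_zero _ _)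

theorem dampedFactor_mul_symm_of_not_mem (ε : ℝ) {z : ℂ} (hz : z ∈ closedBall (0 : ℂ) 1)
    (hΓ : z ∉ P.Γ) : P.dampedFactor ε z * P.symm.dampedFactor ε z =
      P.c⁻¹ * zeroFactor P.S ε z ^ 4 * lipFun f z := by
  have hc := P.c_ne_zero
  have hG := herglotzExp_ne_zero P.ν z
  have hsymm : P.symm.dampedFactor ε z =
      zeroFactor P.S ε z ^ 2 * (lipFun f z / (P.c * herglotzExp P.ν z)) :=
    congrArg (zeroFactor P.S ε z ^ 2 * ·) (P.symm.factor_of_not_mem' hz hΓ)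
  rw [hsymm, dampedFactor, P.factor_of_not_mem hΓ]
  field_simp

theorem dampedFactor_mul_symm (ε : ℝ) {z : ℂ} (hz : z ∈ closedBall (0 : ℂ) 1) :
    P.dampedFactor ε z * P.symm.dampedFactor ε z =
      P.c⁻¹ * zeroFactor P.S ε z ^ 4 * lipFun f z := by
  by_cases hΓ : z ∈ P.Γ
  · by_cases hΓ' : z ∈ P.Γ'
    · simp [dampedFactor, zeroFactor_eq_zero (P.mem_S_iff.2 ⟨hΓ, hΓ'⟩)]
    · rw [mul_comm]
      exact P.symm.dampedFactor_mul_symm_of_not_mem ε hz hΓ'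
  · exact P.dampedFactor_mul_symm_of_not_mem ε hz hΓ

theorem differentiableOn_dampedFactor (hε : 0 < ε) :
    DifferentiableOn ℂ (P.dampedFactor ε) (ball 0 1) := by
  have hnot : ∀ z ∈ ball (0 : ℂ) 1, z ∉ P.Γ := fun z => P.isCarriedBy.not_mem_of_mem_ball
  refine DifferentiableOn.congr (f := fun z => zeroFactor P.S ε z ^ 2 * herglotzExp P.ν z)
    (fun z hz => DifferentiableAt.differentiableWithinAt ?_) fun z hz => by
      rw [dampedFactor, P.factor_of_not_mem (hnot z hz)]
  exact ((P.differentiableAt_zeroFactor hε (ball_subset_closedBall hz)).fun_pow 2).fun_mul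
    (P.isCarriedBy.differentiableAt_herglotzExp (hnot z hz))

theorem continuousAt_zeroFactor (hε : 0 < ε) {z : ℂ} (hz : z ∈ closedBall (0 : ℂ) 1) :
    ContinuousAt (zeroFactor P.S ε) z :=
  (P.differentiableAt_zeroFactor hε hz).continuousAt

theorem continuousWithinAt_dampedFactor_of_mem_S (hε : 0 < ε) {z : ℂ} (hS : z ∈ P.S) :
    ContinuousWithinAt (P.dampedFactor ε) (closedBall 0 1) z := by
  have hb := zeroFactor_eq_zero (ε := ε) hS
  have htendsto : Tendsto (fun w => ‖zeroFactor P.S ε w‖) (𝓝[closedBall 0 1] z) (𝓝 0) := by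
    simpa only [hb, norm_zero] using
      (P.continuousAt_zeroFactor hε (mem_closedBall_zero_iff.2 (P.norm_eq_one_of_mem_S hS).le)
        ).norm.continuousWithinAt.tendsto
  have h0 : P.dampedFactor ε z = 0 := by simp [dampedFactor, hb]
  rw [ContinuousWithinAt, h0]
  refine squeeze_zero_norm' ?_ htendsto
  filter_upwards [self_mem_nhdsWithin] with w hw
  exact P.norm_dampedFactor_le_norm_zeroFactor hε hw

theorem continuousWithinAt_dampedFactor_of_not_mem (hε : 0 < ε) {z : ℂ}
    (hz : z ∈ closedBall (0 : ℂ) 1) (hΓ : z ∉ P.Γ) :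
    ContinuousWithinAt (P.dampedFactor ε) (closedBall 0 1) z := by
  have hG := (P.isCarriedBy.differentiableAt_herglotzExp hΓ).continuousAt
  refine ContinuousAt.continuousWithinAt ?_
  refine (((P.continuousAt_zeroFactor hε hz).pow 2).mul hG).congr ?_
  filter_upwards [P.isClosed.isOpen_compl.mem_nhds hΓ] with w hw
  simp only [Pi.pow_apply, Pi.mul_apply, dampedFactor, P.factor_of_not_mem hw]

theorem continuousWithinAt_dampedFactor_of_not_mem' (hε : 0 < ε) {z : ℂ}
    (hz : z ∈ closedBall (0 : ℂ) 1) (hΓ' : z ∉ P.Γ') :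
    ContinuousWithinAt (P.dampedFactor ε) (closedBall 0 1) z := by
  have hG := (P.isCarriedBy'.differentiableAt_herglotzExp hΓ').continuousAt.continuousWithinAt
    (s := closedBall (0 : ℂ) 1)
  have hquot : ContinuousWithinAt (fun w => zeroFactor P.S ε w ^ 2 *
      (lipFun f w / (P.c * herglotzExp P.ν' w))) (closedBall 0 1) z :=
    ((P.continuousAt_zeroFactor hε hz).continuousWithinAt.pow 2).mul
      ((continuousOn_lipFun f z hz).div (continuousWithinAt_const.mul hG)
        (mul_ne_zero P.c_ne_zero (herglotzExp_ne_zero _ _)))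
  refine hquot.congr_of_eventuallyEq ?_ (by rw [dampedFactor, P.factor_of_not_mem' hz hΓ'])
  filter_upwards [self_mem_nhdsWithin,
    mem_nhdsWithin_of_mem_nhds (P.isClosed'.isOpen_compl.mem_nhds hΓ')] with w hw hw'
  rw [dampedFactor, P.factor_of_not_mem' hw hw']

theorem continuousOn_dampedFactor (hε : 0 < ε) :
    ContinuousOn (P.dampedFactor ε) (closedBall 0 1) := by
  intro z hz
  by_cases hΓ : z ∈ P.Γ
  · by_cases hΓ' : z ∈ P.Γ'
    · exact P.continuousWithinAt_dampedFactor_of_mem_S hε (P.mem_S_iff.2 ⟨hΓ, hΓ'⟩)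
    · exact P.continuousWithinAt_dampedFactor_of_not_mem' hε hz hΓ'
  · exact P.continuousWithinAt_dampedFactor_of_not_mem hε hz hΓ

theorem norm_dampedFactor_sub_le_norm_factor_sub (hε : 0 < ε) {ξ ζ : ℂ}
    (hξ : ξ ∈ closedBall (0 : ℂ) 1) (hζ : ζ ∈ closedBall (0 : ℂ) 1) (hξS : ξ ∉ P.S)
    (hζS : ζ ∉ P.S) :
    ‖P.dampedFactor ε ξ - P.dampedFactor ε ζ‖ ≤
      ‖zeroFactor P.S ε ξ‖ * ‖zeroFactor P.S ε ζ‖ * ‖P.factor ξ - P.factor ζ‖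
        + 2 * ‖zeroFactor P.S ε ξ - zeroFactor P.S ε ζ‖ := by
  set b := zeroFactor P.S ε
  have hle : ∀ x ∈ closedBall (0 : ℂ) 1, x ∉ P.S →
      ‖b x * P.factor x * (b ξ - b ζ)‖ ≤ ‖b ξ - b ζ‖ := fun x hx hxS => by
    rw [norm_mul, norm_mul]
    exact mul_le_of_le_one_left (norm_nonneg _) (mul_le_one₀ (P.norm_zeroFactor_le_one hε hx)
      (norm_nonneg _) (P.norm_factor_le_one hx hxS))
  have hsplit : P.dampedFactor ε ξ - P.dampedFactor ε ζ = b ξ * b ζ * (P.factor ξ - P.factor ζ)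
      + (b ξ * P.factor ξ * (b ξ - b ζ) + b ζ * P.factor ζ * (b ξ - b ζ)) := by
    simp only [dampedFactor, b]
    ring
  rw [hsplit, ← norm_mul, ← norm_mul, two_mul]
  exact (norm_add_le _ _).trans (add_le_add le_rfl
    ((norm_add_le _ _).trans (add_le_add (hle ξ hξ hξS) (hle ζ hζ hζS))))

variable {Λ : ℝ} {ξ ζ : ℂ}

theorem norm_dampedFactor_sub_le_of_mem_of_mem' (hε : 0 < ε) (hΛ : P.S.card / ε ≤ Λ)
    (hξ : ξ ∈ P.Γ) (hζ : ζ ∈ P.Γ') :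
    ‖P.dampedFactor ε ξ - P.dampedFactor ε ζ‖ ≤ 2 * Λ * ‖ξ - ζ‖ := by
  obtain ⟨hbξ, hbζ⟩ := CircleCover.norm_zeroFactor_le_mul hε hΛ hξ hζ
  calc ‖P.dampedFactor ε ξ - P.dampedFactor ε ζ‖
      ≤ ‖P.dampedFactor ε ξ‖ + ‖P.dampedFactor ε ζ‖ := _root_.norm_sub_le _ _
    _ ≤ ‖zeroFactor P.S ε ξ‖ + ‖zeroFactor P.S ε ζ‖ := add_le_add
        (P.norm_dampedFactor_le_norm_zeroFactor hε
          (sphere_subset_closedBall (P.subset_sphere hξ)))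
        (P.norm_dampedFactor_le_norm_zeroFactor hε
          (sphere_subset_closedBall (P.symm.subset_sphere hζ)))
    _ ≤ Λ * ‖ξ - ζ‖ + Λ * ‖ξ - ζ‖ := add_le_add hbξ hbζ
    _ = 2 * Λ * ‖ξ - ζ‖ := by ring

theorem norm_dampedFactor_sub_le_of_not_mem (hε : 0 < ε) (hΛ : P.S.card / ε ≤ Λ) (hΛ0 : 0 < Λ)
    (hξ : ξ ∈ sphere (0 : ℂ) 1) (hζ : ζ ∈ sphere (0 : ℂ) 1) (hξΓ : ξ ∉ P.Γ) (hζΓ : ζ ∉ P.Γ) :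
    ‖P.dampedFactor ε ξ - P.dampedFactor ε ζ‖ ≤
      (2 * P.ν.real univ * Λ ^ 2 + 2 * Λ) * ‖ξ - ζ‖ := by
  have hξc := sphere_subset_closedBall hξ
  have hζc := sphere_subset_closedBall hζ
  have hfactor := P.norm_dampedFactor_sub_le_norm_factor_sub hε hξc hζc (P.not_mem_S hξΓ)
    (P.not_mem_S hζΓ)
  rw [P.factor_of_not_mem hξΓ, P.factor_of_not_mem hζΓ] at hfactor
  linarith [CircleCover.norm_zeroFactor_mul_herglotzExp_sub_le P.isCarriedBy hε hΛ hΛ0 hξ hζ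
    hξΓ hζΓ, CircleCover.norm_zeroFactor_sub_le_mul hε hΛ hξc hζc]

theorem norm_dampedFactor_sub_le_of_not_mem' (hε : 0 < ε) (hΛ : P.S.card / ε ≤ Λ) (hΛ0 : 0 < Λ)
    (hξ : ξ ∈ sphere (0 : ℂ) 1) (hζ : ζ ∈ sphere (0 : ℂ) 1) (hξΓ' : ξ ∉ P.Γ')
    (hζΓ' : ζ ∉ P.Γ') :
    ‖P.dampedFactor ε ξ - P.dampedFactor ε ζ‖ ≤ lipSeminorm f * ω ‖ξ - ζ‖ +
      (2 * P.ν'.real univ * Λ ^ 2 + 2 * Λ) * ‖ξ - ζ‖ := by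
  have hξc := sphere_subset_closedBall hξ
  have hζc := sphere_subset_closedBall hζ
  have hω := mul_nonneg (lipSeminorm_nonneg f) (ω.nonneg_sphere hξ hζ)
  set κ := ‖zeroFactor P.S ε ξ‖ * ‖zeroFactor P.S ε ζ‖
  have hκ1 : κ ≤ 1 := mul_le_one₀ (P.norm_zeroFactor_le_one hε hξc) (norm_nonneg _)
    (P.norm_zeroFactor_le_one hε hζc)
  have hν' : κ * ‖herglotzExp P.ν' ξ - herglotzExp P.ν' ζ‖ ≤
      2 * P.ν'.real univ * Λ ^ 2 * ‖ξ - ζ‖ :=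
    CircleCover.norm_zeroFactor_mul_herglotzExp_sub_le (P := P.toCircleCover.symm)
      P.isCarriedBy' hε hΛ hΛ0 hξ hζ hξΓ' hζΓ'
  calc ‖P.dampedFactor ε ξ - P.dampedFactor ε ζ‖
      ≤ κ * ‖P.factor ξ - P.factor ζ‖ + 2 * ‖zeroFactor P.S ε ξ - zeroFactor P.S ε ζ‖ :=
        P.norm_dampedFactor_sub_le_norm_factor_sub hε hξc hζc (P.symm.not_mem_S hξΓ')
          (P.symm.not_mem_S hζΓ')
    _ ≤ κ * (lipSeminorm f * ω ‖ξ - ζ‖ + ‖herglotzExp P.ν' ξ - herglotzExp P.ν' ζ‖) +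
        2 * (Λ * ‖ξ - ζ‖) := by
        gcongr
        exacts [P.norm_factor_sub_le hξ hζ hξΓ' hζΓ',
          CircleCover.norm_zeroFactor_sub_le_mul hε hΛ hξc hζc]
    _ ≤ _ := by linarith [mul_le_of_le_one_left hω hκ1]

theorem norm_dampedFactor_sub_le (hε : 0 < ε) (hΛ : P.S.card / ε ≤ Λ) (hΛ0 : 0 < Λ)
    (hξ : ξ ∈ sphere (0 : ℂ) 1) (hζ : ζ ∈ sphere (0 : ℂ) 1) :
    ‖P.dampedFactor ε ξ - P.dampedFactor ε ζ‖ ≤ lipSeminorm f * ω ‖ξ - ζ‖ +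
      (2 * (P.ν.real univ + P.ν'.real univ) * Λ ^ 2 + 2 * Λ) * ‖ξ - ζ‖ := by
  have hω := mul_nonneg (lipSeminorm_nonneg f) (ω.nonneg_sphere hξ hζ)
  have hν : 0 ≤ 2 * P.ν.real univ * Λ ^ 2 * ‖ξ - ζ‖ := by positivity
  have hν' : 0 ≤ 2 * P.ν'.real univ * Λ ^ 2 * ‖ξ - ζ‖ := by positivity
  rcases em (ξ ∈ P.Γ), em (ζ ∈ P.Γ) with ⟨hξΓ | hξΓ, hζΓ | hζΓ⟩
  · by_cases hξΓ' : ξ ∈ P.Γ'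
    · have hle := P.norm_dampedFactor_sub_le_of_mem_of_mem' hε hΛ hζΓ hξΓ'
      rw [norm_sub_rev, norm_sub_rev ζ] at hle
      linarith
    by_cases hζΓ' : ζ ∈ P.Γ'
    · linarith [P.norm_dampedFactor_sub_le_of_mem_of_mem' hε hΛ hξΓ hζΓ']
    linarith [P.norm_dampedFactor_sub_le_of_not_mem' hε hΛ hΛ0 hξ hζ hξΓ' hζΓ']
  · linarith [P.norm_dampedFactor_sub_le_of_mem_of_mem' hε hΛ hξΓ
      ((P.mem_or_mem hζ).resolve_left hζΓ)]
  · have hle := P.norm_dampedFactor_sub_le_of_mem_of_mem' hε hΛ hζΓ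
      ((P.mem_or_mem hξ).resolve_left hξΓ)
    rw [norm_sub_rev, norm_sub_rev ζ] at hle
    linarith
  · linarith [P.norm_dampedFactor_sub_le_of_not_mem hε hΛ hΛ0 hξ hζ hξΓ hζΓ]

theorem norm_dampedFactor_sub_le_of_dist (hε : 0 < ε) {z w : ℂ} (hz : z ∈ closedBall (0 : ℂ) 1)
    (hw : w ∈ closedBall (0 : ℂ) 1) {r s : ℝ} (hr : 0 < r) (hs : 0 < s)
    (hzr : ∀ γ ∈ P.Γ, r ≤ ‖γ - z‖) (hws : ∀ γ ∈ P.Γ, s ≤ ‖γ - w‖) :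
    ‖P.dampedFactor ε z - P.dampedFactor ε w‖ ≤
      (2 * P.ν.real univ + 2 * (P.S.card * ε)) * ‖z - w‖ / (r * s) := by
  have hzΓ : z ∉ P.Γ := fun h => hr.not_ge (by simpa using hzr z h)
  have hwΓ : w ∉ P.Γ := fun h => hs.not_ge (by simpa using hws w h)
  have hz1 := mem_closedBall_zero_iff.1 hz
  have hw1 := mem_closedBall_zero_iff.1 hw
  have hS : ∀ p ∈ P.S, r * s ≤ ‖z - (1 + ε) * p‖ * ‖w - (1 + ε) * p‖ := fun p hp => by
    have hp1 := P.norm_eq_one_of_mem_S hp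
    have hpΓ := (P.mem_S_iff.1 hp).1
    refine mul_le_mul ?_ ?_ hs.le (norm_nonneg _)
    · exact (norm_sub_rev z p ▸ hzr p hpΓ).trans
        (norm_sub_le_norm_sub_one_add_mul hp1 hε.le hz1)
    · exact (norm_sub_rev w p ▸ hws p hpΓ).trans
        (norm_sub_le_norm_sub_one_add_mul hp1 hε.le hw1)
  have hκ1 : ‖zeroFactor P.S ε z‖ * ‖zeroFactor P.S ε w‖ ≤ 1 :=
    mul_le_one₀ (P.norm_zeroFactor_le_one hε hz) (norm_nonneg _) (P.norm_zeroFactor_le_one hε hw)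
  calc ‖P.dampedFactor ε z - P.dampedFactor ε w‖
      ≤ ‖herglotzExp P.ν z - herglotzExp P.ν w‖ +
        2 * ‖zeroFactor P.S ε z - zeroFactor P.S ε w‖ := by
        have hfactor := P.norm_dampedFactor_sub_le_norm_factor_sub hε hz hw (P.not_mem_S hzΓ)
          (P.not_mem_S hwΓ)
        rw [P.factor_of_not_mem hzΓ, P.factor_of_not_mem hwΓ] at hfactor
        exact hfactor.trans (add_le_add (mul_le_of_le_one_left (norm_nonneg _) hκ1) le_rfl)
    _ ≤ 2 * ‖z - w‖ / (r * s) * P.ν.real univ + 2 * (P.S.card * ε * ‖z - w‖ / (r * s)) := by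
        gcongr
        · exact P.isCarriedBy.norm_herglotzExp_sub_le hzΓ hwΓ hz1 hw1 (mul_pos hr hs)
            fun γ hγ => mul_le_mul (hzr γ hγ) (hws γ hγ) hs.le (norm_nonneg _)
        · exact norm_zeroFactor_sub_le (fun _ => P.norm_eq_one_of_mem_S) hε hz1 hw1
            (mul_pos hr hs) hS
    _ = _ := by ring

theorem norm_one_sub_dampedFactor_le (hε : 0 < ε) {z : ℂ} (hz : z ∈ closedBall (0 : ℂ) 1) {r : ℝ}
    (hr : 0 < r) (hzr : ∀ γ ∈ P.Γ, r ≤ ‖γ - z‖) :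
    ‖1 - P.dampedFactor ε z‖ ≤ (2 * P.ν.real univ + 2 * (P.S.card * ε)) / r := by
  have hzΓ : z ∉ P.Γ := fun h => hr.not_ge (by simpa using hzr z h)
  have hz1 := mem_closedBall_zero_iff.1 hz
  set b := zeroFactor P.S ε z with hb_def
  have hb : ‖b‖ ≤ 1 := P.norm_zeroFactor_le_one hε hz
  have hone_sub : ‖1 - b‖ ≤ P.S.card * ε / r :=
    norm_one_sub_zeroFactor_le (fun _ => P.norm_eq_one_of_mem_S) hε hz1 hr
      fun p hp => hzr p (P.mem_S_iff.1 hp).1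
  have hexp := P.isCarriedBy.norm_one_sub_herglotzExp_le hzΓ hz1 hr hzr
  have hsplit : 1 - P.dampedFactor ε z =
      (1 - b) + b * (1 - b) + b ^ 2 * (1 - herglotzExp P.ν z) := by
    rw [dampedFactor, P.factor_of_not_mem hzΓ, ← hb_def]
    ring
  calc ‖1 - P.dampedFactor ε z‖
      ≤ ‖1 - b‖ + ‖b‖ * ‖1 - b‖ + ‖b‖ ^ 2 * ‖1 - herglotzExp P.ν z‖ := by
        rw [hsplit, ← norm_pow, ← norm_mul, ← norm_mul]
        exact norm_add₃_le
    _ ≤ P.S.card * ε / r + 1 * (P.S.card * ε / r) + 1 ^ 2 * (2 / r * P.ν.real univ) := by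
        gcongr
    _ = _ := by ring

theorem exists_lipFun_eq_dampedFactor (hε : 0 < ε) :
    ∃ V : LipAlgebra ω, ∀ z ∈ closedBall (0 : ℂ) 1, lipFun V z = P.dampedFactor ε z := by
  have hω2 : 0 < ω 2 := ω.pos two_pos le_rfl
  set Λ := P.S.card / ε + 1
  set C := 2 * (P.ν.real univ + P.ν'.real univ) * Λ ^ 2 + 2 * Λ
  refine exists_lipFun_eq ω (P.continuousOn_dampedFactor hε) (P.differentiableOn_dampedFactor hε)
    (a := lipSeminorm f + C * (2 / ω 2)) (add_nonneg (lipSeminorm_nonneg f) (by positivity))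
    fun ξ hξ ζ hζ => ?_
  calc ‖P.dampedFactor ε ξ - P.dampedFactor ε ζ‖
      ≤ lipSeminorm f * ω ‖ξ - ζ‖ + C * ‖ξ - ζ‖ :=
        P.norm_dampedFactor_sub_le hε (le_add_of_nonneg_right zero_le_one) (by positivity) hξ hζ
    _ ≤ lipSeminorm f * ω ‖ξ - ζ‖ + C * (2 / ω 2 * ω ‖ξ - ζ‖) := by
        gcongr
        exact ω.self_le_mul (norm_nonneg _) (norm_sub_le_two_of_sphere hξ hζ)
    _ = _ := by ring

theorem exists_lipFun_eq_zeroFactor (hε : 0 < ε) :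
    ∃ B : LipAlgebra ω, ∀ z ∈ closedBall (0 : ℂ) 1, lipFun B z = zeroFactor P.S ε z := by
  have hω2 : 0 < ω 2 := ω.pos two_pos le_rfl
  refine exists_lipFun_eq ω
    (fun z hz => (P.continuousAt_zeroFactor hε hz).continuousWithinAt)
    (fun z hz =>
      (P.differentiableAt_zeroFactor hε (ball_subset_closedBall hz)).differentiableWithinAt)
    (a := P.S.card / ε * (2 / ω 2)) (by positivity) fun ξ hξ ζ hζ => ?_
  rw [mul_assoc]
  exact (CircleCover.norm_zeroFactor_sub_le_mul hε le_rfl (sphere_subset_closedBall hξ)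
    (sphere_subset_closedBall hζ)).trans (mul_le_mul_of_nonneg_left
      (ω.self_le_mul (norm_nonneg _) (norm_sub_le_two_of_sphere hξ hζ)) (by positivity))

theorem exists_mem_lipFun_eq_dampedFactor (hε : 0 < ε) {K : Ideal (LipAlgebra ω)} (hf : f ∈ K)
    (hK : ∀ w ∈ closedBall (0 : ℂ) 1, (∀ k ∈ K, lipFun k w = 0) → w ∉ P.Γ') :
    ∃ V ∈ K, ∀ z ∈ closedBall (0 : ℂ) 1, lipFun V z = P.dampedFactor ε z := by
  obtain ⟨V, hV⟩ := P.exists_lipFun_eq_dampedFactor hε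
  obtain ⟨V', hV'⟩ := P.symm.exists_lipFun_eq_dampedFactor hε
  obtain ⟨B, hB⟩ := P.exists_lipFun_eq_zeroFactor hε
  have hprod : V * V' = algebraMap ℂ _ P.c⁻¹ * (B * B * (B * B)) * f := ext_lipFun fun z hz => by
    simp only [lipFun_mul, lipFun_algebraMap _ hz, hB z hz, hV z hz, hV' z hz,
      P.dampedFactor_mul_symm ε hz]
    ring
  refine ⟨V, mem_of_mul_mem_of_forall_ne_zero (hprod ▸ K.mul_mem_left _ hf) fun w hw h => ?_, hV⟩
  rw [hV' w hw]
  exact P.symm.dampedFactor_ne_zero hε hw (hK w hw h)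

end OuterSplitting

end LipAlgebra

/-! ### Approximating `g` by multiples of `g` -/

namespace LipAlgebra

variable {ω : ModulusOfContinuity}

theorem isClosed_hull (I : Ideal (LipAlgebra ω)) : IsClosed (hull I) := by
  have hull_eq : hull I = ⋂ f ∈ I, sphere (0 : ℂ) 1 ∩ lipFun f ⁻¹' {0} := by
    ext ξ
    simp only [hull, mem_ofPred_eq, mem_iInter, mem_inter_iff, mem_preimage, mem_singleton_iff]
    exact ⟨fun h f hf => ⟨h.1, h.2 f hf⟩, fun h => ⟨(h 0 I.zero_mem).1, fun f hf => (h f hf).2⟩⟩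
  rw [hull_eq]
  exact isClosed_biInter fun f _ => ((continuousOn_lipFun f).mono
    sphere_subset_closedBall).preimage_isClosed_of_isClosed isClosed_sphere isClosed_singleton

theorem infDist_le_two_of_sphere {E : Set ℂ} (hE1 : E ⊆ sphere 0 1) (hne : E.Nonempty) {ξ : ℂ}
    (hξ : ξ ∈ sphere (0 : ℂ) 1) : infDist ξ E ≤ 2 := by
  obtain ⟨e, he⟩ := hne
  refine (infDist_le_dist_of_mem he).trans ?_
  rw [dist_eq_norm]
  exact norm_sub_le_two_of_sphere hξ (hE1 he)

/-- `g` vanishes on `E`, and at distance at most `δ` from `E` its modulus of continuity is at most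
`τ * ω`. This is one instance of the condition which defines `smallSpace ω E`. -/
structure IsSmallNear (g : LipAlgebra ω) (E : Set ℂ) (δ τ : ℝ) : Prop where
  eq_zero : ∀ ξ ∈ E, lipFun g ξ = 0
  norm_sub_le : ∀ ξ ∈ sphere (0 : ℂ) 1, ∀ ζ ∈ sphere (0 : ℂ) 1, infDist ξ E ≤ δ →
    infDist ζ E ≤ δ → ‖lipFun g ξ - lipFun g ζ‖ ≤ τ * ω ‖ξ - ζ‖

/-- `v` resembles the constant `1` off `E`: at distance at least `δ` from `E` it is `τ`-close to
`1`, and its increments, which are at most `C * ω` when weighted by `ω` of the distance to `E`, are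
even at most `τ * ω` there. -/
structure IsAlmostOneOff (v : LipAlgebra ω) (E : Set ℂ) (C δ τ : ℝ) : Prop where
  norm_le_one : ∀ z ∈ closedBall (0 : ℂ) 1, ‖lipFun v z‖ ≤ 1
  norm_sub_mul_le : ∀ ξ ∈ sphere (0 : ℂ) 1, ξ ∉ E → ∀ ζ ∈ sphere (0 : ℂ) 1,
    ‖lipFun v ξ - lipFun v ζ‖ * ω (infDist ξ E) ≤ C * ω ‖ξ - ζ‖
  norm_one_sub_le : ∀ ξ ∈ sphere (0 : ℂ) 1, δ ≤ infDist ξ E → ‖1 - lipFun v ξ‖ ≤ τ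
  norm_sub_le : ∀ ξ ∈ sphere (0 : ℂ) 1, ∀ ζ ∈ sphere (0 : ℂ) 1, δ ≤ infDist ξ E →
    δ ≤ infDist ζ E → ‖lipFun v ξ - lipFun v ζ‖ ≤ τ * ω ‖ξ - ζ‖

theorem exists_isSmallNear {E : Set ℂ} (hE : IsCompact E) (hne : E.Nonempty) {g : LipAlgebra ω}
    (hg : g ∈ smallSpace ω E) {τ : ℝ} (hτ : 0 < τ) : ∃ δ > 0, IsSmallNear g E δ τ := by
  obtain ⟨δ, hδ, hsmall⟩ := hg.2 τ hτ
  have mem_circleNhd : ∀ x ∈ sphere (0 : ℂ) 1, infDist x E ≤ δ → x ∈ circleNhd E δ := by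
    intro x hx hd
    obtain ⟨e, he, hxe⟩ := hE.exists_infDist_eq_dist hne x
    exact ⟨hx, mem_cthickening_of_dist_le x e δ E he (hxe ▸ hd)⟩
  refine ⟨δ, hδ, hg.1, fun ξ hξ ζ hζ hdξ hdζ => ?_⟩
  by_cases hξζ : ξ = ζ
  · simp [hξζ, ω.zero']
  · exact (div_le_iff₀ (ω.pos (norm_pos_iff.2 (sub_ne_zero.2 hξζ))
      (norm_sub_le_two_of_sphere hξ hζ))).1
      (hsmall _ ⟨ξ, mem_circleNhd ξ hξ hdξ, ζ, mem_circleNhd ζ hζ hdζ, hξζ, rfl⟩)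

theorem IsSmallNear.norm_lipFun_le {E : Set ℂ} {g : LipAlgebra ω} {δ τ : ℝ}
    (hg : IsSmallNear g E δ τ) (hE : IsCompact E) (hE1 : E ⊆ sphere 0 1) (hne : E.Nonempty)
    (hδ : 0 ≤ δ) {ξ : ℂ} (hξ : ξ ∈ sphere (0 : ℂ) 1) (hd : infDist ξ E ≤ δ) :
    ‖lipFun g ξ‖ ≤ τ * ω (infDist ξ E) := by
  obtain ⟨e, he, hξe⟩ := hE.exists_infDist_eq_dist hne ξ
  have hle := hg.norm_sub_le ξ hξ e (hE1 he) hd ((infDist_zero_of_mem he).trans_le hδ)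
  rwa [hg.eq_zero e he, sub_zero, ← dist_eq_norm, ← hξe] at hle

theorem lipFun_sub_mul_self (g v : LipAlgebra ω) {z : ℂ} :
    lipFun (g - g * v) z = lipFun g z * (1 - lipFun v z) := by
  rw [lipFun_sub, lipFun_mul, mul_one_sub]

theorem lipFun_sub_mul_self_sub (g v : LipAlgebra ω) (ξ ζ : ℂ) :
    lipFun (g - g * v) ξ - lipFun (g - g * v) ζ =
      (1 - lipFun v ζ) * (lipFun g ξ - lipFun g ζ) -
        lipFun g ξ * (lipFun v ξ - lipFun v ζ) := by
  rw [lipFun_sub_mul_self, lipFun_sub_mul_self]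
  ring

namespace IsAlmostOneOff

variable {E : Set ℂ} {g v : LipAlgebra ω} {C δ τ : ℝ}

theorem norm_one_sub_le_two (hv : IsAlmostOneOff v E C δ τ) {z : ℂ}
    (hz : z ∈ sphere (0 : ℂ) 1) : ‖1 - lipFun v z‖ ≤ 2 := by
  have hle := _root_.norm_sub_le 1 (lipFun v z)
  rw [norm_one] at hle
  linarith [hv.norm_le_one z (sphere_subset_closedBall hz)]

theorem supNorm_sub_mul_le (hv : IsAlmostOneOff v E C δ τ) (hg : IsSmallNear g E δ τ)
    (hE : IsCompact E) (hE1 : E ⊆ sphere 0 1) (hne : E.Nonempty) (hδ : 0 ≤ δ) (hτ : 0 ≤ τ) :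
    supNorm (g - g * v) ≤ (2 * ω 2 + supNorm g) * τ := by
  refine supNorm_le_of_sphere fun ξ hξ => ?_
  have hN := supNorm_nonneg g
  have hω2 : 0 < ω 2 := ω.pos two_pos le_rfl
  rw [lipFun_sub_mul_self, norm_mul, add_mul]
  rcases le_total δ (infDist ξ E) with hd | hd
  · calc ‖lipFun g ξ‖ * ‖1 - lipFun v ξ‖ ≤ supNorm g * τ := mul_le_mul
          (norm_lipFun_le g (sphere_subset_closedBall hξ)) (hv.norm_one_sub_le ξ hξ hd)
          (norm_nonneg _) hN
      _ ≤ _ := le_add_of_nonneg_left (by positivity)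
  · have hωd : ω (infDist ξ E) ≤ ω 2 :=
      ω.le_of_le infDist_nonneg (infDist_le_two_of_sphere hE1 hne hξ) le_rfl
    calc ‖lipFun g ξ‖ * ‖1 - lipFun v ξ‖ ≤ (τ * ω 2) * 2 := mul_le_mul
          ((hg.norm_lipFun_le hE hE1 hne hδ hξ hd).trans (mul_le_mul_of_nonneg_left hωd hτ))
          (hv.norm_one_sub_le_two hξ) (norm_nonneg _) (by positivity)
      _ = 2 * ω 2 * τ := by ring
      _ ≤ _ := le_add_of_nonneg_right (by positivity)

theorem norm_one_sub_mul_sub_le (hv : IsAlmostOneOff v E C δ τ) (hg : IsSmallNear g E δ τ)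
    (hτ : 0 ≤ τ) {ξ ζ : ℂ} (hξ : ξ ∈ sphere (0 : ℂ) 1) (hζ : ζ ∈ sphere (0 : ℂ) 1)
    (hd : infDist ξ E ≤ δ) :
    ‖(1 - lipFun v ζ) * (lipFun g ξ - lipFun g ζ)‖ ≤ (lipSeminorm g + 2) * τ * ω ‖ξ - ζ‖ := by
  have hωt := ω.nonneg_sphere hξ hζ
  have hL := lipSeminorm_nonneg g
  have hτω : 0 ≤ τ * ω ‖ξ - ζ‖ := mul_nonneg hτ hωt
  rw [norm_mul]
  rcases le_total δ (infDist ζ E) with hd' | hd'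
  · have := mul_le_mul (hv.norm_one_sub_le ζ hζ hd') (norm_lipFun_sub_le g hξ hζ)
      (norm_nonneg _) hτ
    linarith
  · have := mul_le_mul (hv.norm_one_sub_le_two hζ) (hg.norm_sub_le ξ hξ ζ hζ hd hd')
      (norm_nonneg _) two_pos.le
    linarith [mul_nonneg hL hτω]

theorem norm_mul_sub_le (hv : IsAlmostOneOff v E C δ τ) (hg : IsSmallNear g E δ τ)
    (hE : IsCompact E) (hE1 : E ⊆ sphere 0 1) (hne : E.Nonempty) (hC : 0 ≤ C) (hδ : 0 ≤ δ)
    (hτ : 0 ≤ τ) {ξ ζ : ℂ} (hξ : ξ ∈ sphere (0 : ℂ) 1) (hζ : ζ ∈ sphere (0 : ℂ) 1)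
    (hd : infDist ξ E ≤ δ) :
    ‖lipFun g ξ * (lipFun v ξ - lipFun v ζ)‖ ≤ C * τ * ω ‖ξ - ζ‖ := by
  have hωt := ω.nonneg_sphere hξ hζ
  by_cases hξE : ξ ∈ E
  · rw [hg.eq_zero ξ hξE, zero_mul, norm_zero]
    positivity
  · calc ‖lipFun g ξ * (lipFun v ξ - lipFun v ζ)‖
        ≤ (τ * ω (infDist ξ E)) * ‖lipFun v ξ - lipFun v ζ‖ := by
          rw [norm_mul]
          gcongr
          exact hg.norm_lipFun_le hE hE1 hne hδ hξ hd
      _ = τ * (‖lipFun v ξ - lipFun v ζ‖ * ω (infDist ξ E)) := by ring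
      _ ≤ τ * (C * ω ‖ξ - ζ‖) :=
          mul_le_mul_of_nonneg_left (hv.norm_sub_mul_le ξ hξ hξE ζ hζ) hτ
      _ = C * τ * ω ‖ξ - ζ‖ := by ring

theorem norm_sub_mul_sub_le_of_infDist_le (hv : IsAlmostOneOff v E C δ τ)
    (hg : IsSmallNear g E δ τ) (hE : IsCompact E) (hE1 : E ⊆ sphere 0 1) (hne : E.Nonempty)
    (hC : 0 ≤ C) (hδ : 0 ≤ δ) (hτ : 0 ≤ τ) {ξ ζ : ℂ} (hξ : ξ ∈ sphere (0 : ℂ) 1)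
    (hζ : ζ ∈ sphere (0 : ℂ) 1) (hd : infDist ξ E ≤ δ) :
    ‖lipFun (g - g * v) ξ - lipFun (g - g * v) ζ‖ ≤
      (lipSeminorm g + 2 + C) * τ * ω ‖ξ - ζ‖ := by
  rw [lipFun_sub_mul_self_sub]
  linarith [_root_.norm_sub_le ((1 - lipFun v ζ) * (lipFun g ξ - lipFun g ζ))
    (lipFun g ξ * (lipFun v ξ - lipFun v ζ)), hv.norm_one_sub_mul_sub_le hg hτ hξ hζ hd,
    hv.norm_mul_sub_le hg hE hE1 hne hC hδ hτ hξ hζ hd]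

theorem norm_sub_mul_sub_le_of_le_infDist (hv : IsAlmostOneOff v E C δ τ) (hτ : 0 ≤ τ) {ξ ζ : ℂ}
    (hξ : ξ ∈ sphere (0 : ℂ) 1) (hζ : ζ ∈ sphere (0 : ℂ) 1) (hdξ : δ ≤ infDist ξ E)
    (hdζ : δ ≤ infDist ζ E) :
    ‖lipFun (g - g * v) ξ - lipFun (g - g * v) ζ‖ ≤
      (lipSeminorm g + supNorm g) * τ * ω ‖ξ - ζ‖ := by
  rw [lipFun_sub_mul_self_sub]
  calc _ ≤ ‖1 - lipFun v ζ‖ * ‖lipFun g ξ - lipFun g ζ‖ +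
        ‖lipFun g ξ‖ * ‖lipFun v ξ - lipFun v ζ‖ := by
        rw [← norm_mul, ← norm_mul]
        exact _root_.norm_sub_le _ _
    _ ≤ τ * (lipSeminorm g * ω ‖ξ - ζ‖) + supNorm g * (τ * ω ‖ξ - ζ‖) := add_le_add
        (mul_le_mul (hv.norm_one_sub_le ζ hζ hdζ) (norm_lipFun_sub_le g hξ hζ)
          (norm_nonneg _) hτ)
        (mul_le_mul (norm_lipFun_le g (sphere_subset_closedBall hξ))
          (hv.norm_sub_le ξ hξ ζ hζ hdξ hdζ) (norm_nonneg _) (supNorm_nonneg g))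
    _ = _ := by ring

theorem lipSeminorm_sub_mul_le (hv : IsAlmostOneOff v E C δ τ) (hg : IsSmallNear g E δ τ)
    (hE : IsCompact E) (hE1 : E ⊆ sphere 0 1) (hne : E.Nonempty) (hC : 0 ≤ C) (hδ : 0 ≤ δ)
    (hτ : 0 ≤ τ) :
    lipSeminorm (g - g * v) ≤ (lipSeminorm g + supNorm g + 2 + C) * τ := by
  have hL := lipSeminorm_nonneg g
  have hN := supNorm_nonneg g
  refine lipSeminorm_le (by positivity) fun ξ hξ ζ hζ => ?_
  have hτω : 0 ≤ τ * ω ‖ξ - ζ‖ := mul_nonneg hτ (ω.nonneg_sphere hξ hζ)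
  rcases le_total (infDist ξ E) δ with hdξ | hdξ
  · linarith [hv.norm_sub_mul_sub_le_of_infDist_le hg hE hE1 hne hC hδ hτ hξ hζ hdξ,
      mul_nonneg hN hτω]
  rcases le_total (infDist ζ E) δ with hdζ | hdζ
  · rw [norm_sub_rev, norm_sub_rev ξ]
    rw [norm_sub_rev] at hτω
    linarith [hv.norm_sub_mul_sub_le_of_infDist_le hg hE hE1 hne hC hδ hτ hζ hξ hdζ,
      mul_nonneg hN hτω]
  · linarith [hv.norm_sub_mul_sub_le_of_le_infDist (g := g) hτ hξ hζ hdξ hdζ, mul_nonneg hC hτω]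

end IsAlmostOneOff

theorem mem_of_forall_exists_isAlmostOneOff {I : Ideal (LipAlgebra ω)} (hI : IsNormClosed I)
    {E : Set ℂ} (hE : IsClosed E) (hE1 : E ⊆ sphere 0 1) (hne : E.Nonempty) {g : LipAlgebra ω}
    (hg : g ∈ smallSpace ω E) {C : ℝ} (hC : 0 ≤ C)
    (h : ∀ δ > 0, ∀ τ > 0, ∃ v, g * v ∈ I ∧ IsAlmostOneOff v E C δ τ) : g ∈ I := by
  have hEc : IsCompact E := (isCompact_sphere 0 1).of_isClosed_subset hE hE1
  have hω2 : 0 < ω 2 := ω.pos two_pos le_rfl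
  have hN := supNorm_nonneg g
  have hL := lipSeminorm_nonneg g
  refine hI g fun ε hε => ?_
  set Q := (2 * ω 2 + supNorm g) + (lipSeminorm g + supNorm g + 2 + C)
  have hQ : 0 < Q := by positivity
  have hτ : 0 < ε / (2 * Q) := by positivity
  obtain ⟨δ, hδ, hgδ⟩ := exists_isSmallNear hEc hne hg hτ
  obtain ⟨v, hgv, hv⟩ := h δ hδ _ hτ
  refine ⟨g * v, hgv, ?_⟩
  calc lipNorm (g - g * v) = supNorm (g - g * v) + lipSeminorm (g - g * v) := lipNorm_eq _
    _ ≤ (2 * ω 2 + supNorm g) * (ε / (2 * Q)) +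
        (lipSeminorm g + supNorm g + 2 + C) * (ε / (2 * Q)) :=
        add_le_add (hv.supNorm_sub_mul_le hgδ hEc hE1 hne hδ.le hτ.le)
          (hv.lipSeminorm_sub_mul_le hgδ hEc hE1 hne hC hδ.le hτ.le)
    _ = Q * (ε / (2 * Q)) := (add_mul _ _ _).symm
    _ = ε / 2 := by field_simp
    _ < ε := half_lt_self hε

end LipAlgebra

/-! ### Estimates at a given scale -/

namespace LipAlgebra

variable {ω : ModulusOfContinuity} {f : LipAlgebra ω} {ν : Measure ℂ} {E : Set ℂ}

namespace OuterSplitting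

/-- The splitting follows `E` at scale `1 / M`: its set `Γ` lies within `8 / M` of `E`, and there
are at most `M` points to be damped. -/
structure IsLocalizedNear (P : OuterSplitting f) (E : Set ℂ) (M : ℕ) : Prop where
  pos : 0 < M
  card_le : P.S.card ≤ M
  exists_norm_sub_le : ∀ x ∈ P.Γ, ∃ e ∈ E, ‖x - e‖ ≤ 8 / M

end OuterSplitting

theorem IsRepresentedBy.exists_outerSplitting [IsFiniteMeasure ν] (hf : IsRepresentedBy f ν)
    (E : Set ℂ) {M : ℕ} (hM : 0 < M) :
    ∃ P : OuterSplitting f, P.IsLocalizedNear E M ∧ (∀ x ∈ P.Γ', x ∉ E) ∧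
      P.ν.real univ ≤ ν.real (cthickening (8 / M) E) ∧
      P.ν.real univ + P.ν'.real univ = ν.real univ := by
  obtain ⟨Q, hcard, hfar, hnear⟩ := exists_circleCover_near E hM
  obtain ⟨hν, c, hc, hfc⟩ := hf
  have hQ := Q.isClosed.measurableSet
  refine ⟨
    { toCircleCover := Q
      ν := ν.restrict Q.Γ
      ν' := ν.restrict Q.Γᶜ
      c := c
      isFiniteMeasure := inferInstance
      isFiniteMeasure' := inferInstance
      isCarriedBy := isCarriedBy_restrict ν Q.isClosed Q.subset_sphere
      isCarriedBy' := ⟨Q.isClosed', Q.symm.subset_sphere, by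
        filter_upwards [ae_restrict_mem hQ.compl, ae_restrict_of_ae hν.ae_mem] with ξ hξΓ hξ
        exact (Q.mem_or_mem hξ).resolve_left hξΓ⟩
      norm_c := hc
      eq_mul := fun z hz => ?_ }, ⟨hM, hcard, hnear⟩, fun x hx hxE => ?_, ?_, ?_⟩
  · have hint := hν.integrable_herglotz_kernel (not_mem_sphere_of_mem_ball hz)
    rw [hfc z hz, herglotzExp, herglotzExp, herglotzExp, ← Complex.exp_add, ← neg_add,
      herglotzIntegral, herglotzIntegral, herglotzIntegral, integral_add_compl hQ hint]
  · have hlt := hfar x hx x hxE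
    rw [sub_self, norm_zero] at hlt
    exact hlt.not_ge (by positivity)
  · rw [measureReal_restrict_apply_univ]
    refine measureReal_mono fun x hx => ?_
    obtain ⟨e, he, hxe⟩ := hnear x hx
    exact mem_cthickening_of_dist_le x e _ E he (by rwa [dist_eq_norm])
  · rw [measureReal_restrict_apply_univ, measureReal_restrict_apply_univ,
      measureReal_add_measureReal_compl hQ]

namespace OuterSplitting.IsLocalizedNear

variable {P : OuterSplitting f} {M : ℕ} {ξ ζ : ℂ}

theorem one_le (h : P.IsLocalizedNear E M) : (1 : ℝ) ≤ M := Nat.one_le_cast.2 h.pos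

theorem one_div_sq_pos (h : P.IsLocalizedNear E M) : 0 < 1 / (M : ℝ) ^ 2 :=
  one_div_pos.2 (pow_pos (one_pos.trans_le h.one_le) 2)

theorem card_div_le (h : P.IsLocalizedNear E M) :
    P.S.card / (1 / (M : ℝ) ^ 2) ≤ (M : ℝ) ^ 3 := by
  have hcard : (P.S.card : ℝ) ≤ M := Nat.cast_le.2 h.card_le
  rw [div_div_eq_mul_div, div_one, pow_succ' (M : ℝ) 2]
  gcongr

theorem card_mul_le (h : P.IsLocalizedNear E M) : P.S.card * (1 / (M : ℝ) ^ 2) ≤ 1 / M := by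
  have hM : (0 : ℝ) < M := one_pos.trans_le h.one_le
  calc (P.S.card : ℝ) * (1 / (M : ℝ) ^ 2) ≤ (M : ℝ) * (1 / (M : ℝ) ^ 2) := by
        gcongr
        exact h.card_le
    _ = 1 / (M : ℝ) := by field_simp

theorem half_le_norm_sub (h : P.IsLocalizedNear E M) {δ : ℝ} (hδ : 16 / M ≤ δ)
    (hd : δ ≤ infDist ξ E) {γ : ℂ} (hγ : γ ∈ P.Γ) : δ / 2 ≤ ‖γ - ξ‖ := by
  obtain ⟨e, he, hγe⟩ := h.exists_norm_sub_le γ hγ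
  have hξe : infDist ξ E ≤ ‖γ - ξ‖ + ‖γ - e‖ := calc
    infDist ξ E ≤ dist ξ e := infDist_le_dist_of_mem he
    _ ≤ dist γ ξ + dist γ e := dist_triangle_left ξ e γ
    _ = ‖γ - ξ‖ + ‖γ - e‖ := by rw [dist_eq_norm, dist_eq_norm]
  have hhalf : (8 : ℝ) / M = (16 / M) / 2 := by ring
  linarith

theorem norm_one_sub_dampedFactor_le (h : P.IsLocalizedNear E M) {δ : ℝ} (hδ : 16 / M ≤ δ)
    (hξ : ξ ∈ sphere (0 : ℂ) 1) (hd : δ ≤ infDist ξ E) :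
    ‖1 - P.dampedFactor (1 / (M : ℝ) ^ 2) ξ‖ ≤ (2 * P.ν.real univ + 2 / M) / (δ / 2) := by
  have hM : (0 : ℝ) < M := one_pos.trans_le h.one_le
  have hδ0 : 0 < δ := (by positivity : (0 : ℝ) < 16 / M).trans_le hδ
  refine (P.norm_one_sub_dampedFactor_le h.one_div_sq_pos (sphere_subset_closedBall hξ)
    (half_pos hδ0) fun γ => h.half_le_norm_sub hδ hd).trans ?_
  gcongr
  linarith [h.card_mul_le, (by ring : (2 : ℝ) / M = 2 * (1 / M))]

theorem norm_dampedFactor_sub_le_of_le_infDist (h : P.IsLocalizedNear E M) {δ : ℝ}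
    (hδ : 16 / M ≤ δ) (hξ : ξ ∈ sphere (0 : ℂ) 1) (hζ : ζ ∈ sphere (0 : ℂ) 1)
    (hdξ : δ ≤ infDist ξ E) (hdζ : δ ≤ infDist ζ E) :
    ‖P.dampedFactor (1 / (M : ℝ) ^ 2) ξ - P.dampedFactor (1 / (M : ℝ) ^ 2) ζ‖ ≤
      (2 * P.ν.real univ + 2 / M) / (δ / 2 * (δ / 2)) * ‖ξ - ζ‖ := by
  have hM : (0 : ℝ) < M := one_pos.trans_le h.one_le
  have hδ0 : 0 < δ := (by positivity : (0 : ℝ) < 16 / M).trans_le hδ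
  refine (P.norm_dampedFactor_sub_le_of_dist h.one_div_sq_pos (sphere_subset_closedBall hξ)
    (sphere_subset_closedBall hζ) (half_pos hδ0) (half_pos hδ0)
    (fun γ => h.half_le_norm_sub hδ hdξ) fun γ => h.half_le_norm_sub hδ hdζ).trans ?_
  rw [mul_div_right_comm]
  gcongr
  linarith [h.card_mul_le, (by ring : (2 : ℝ) / M = 2 * (1 / M))]

variable {s : ℝ}

theorem norm_dampedFactor_sub_le_of_mul_le (h : P.IsLocalizedNear E M)
    (hξ : ξ ∈ sphere (0 : ℂ) 1) (hζ : ζ ∈ sphere (0 : ℂ) 1) (hs : 0 < s) (hs1 : s ≤ 1)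
    (hMs : M * s ≤ 8) :
    ‖P.dampedFactor (1 / (M : ℝ) ^ 2) ξ - P.dampedFactor (1 / (M : ℝ) ^ 2) ζ‖ ≤
      lipSeminorm f * ω ‖ξ - ζ‖ +
        (2 * (P.ν.real univ + P.ν'.real univ) + 4) * 8 ^ 6 * (‖ξ - ζ‖ / s ^ 8) := by
  have hM : (0 : ℝ) < M := one_pos.trans_le h.one_le
  have hM36 : (M : ℝ) ^ 3 ≤ (M : ℝ) ^ 6 := pow_le_pow_right₀ h.one_le (by norm_num)
  have hMs' : (M : ℝ) ≤ 8 / s := (le_div_iff₀ hs).2 hMs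
  set m := P.ν.real univ + P.ν'.real univ
  refine (P.norm_dampedFactor_sub_le h.one_div_sq_pos h.card_div_le (by positivity) hξ hζ).trans
    (add_le_add le_rfl ?_)
  calc (2 * m * ((M : ℝ) ^ 3) ^ 2 + 2 * (M : ℝ) ^ 3) * ‖ξ - ζ‖
      ≤ (2 * m * (M : ℝ) ^ 6 + 4 * (M : ℝ) ^ 6) * ‖ξ - ζ‖ := by
        rw [← pow_mul]
        gcongr
        norm_num
    _ = (2 * m + 4) * (M : ℝ) ^ 6 * ‖ξ - ζ‖ := by ring
    _ ≤ (2 * m + 4) * (8 / s) ^ 6 * ‖ξ - ζ‖ := by gcongr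
    _ = (2 * m + 4) * 8 ^ 6 * (‖ξ - ζ‖ / s ^ 6) := by ring
    _ ≤ (2 * m + 4) * 8 ^ 6 * (‖ξ - ζ‖ / s ^ 8) := by
        have := pow_le_pow_of_le_one hs.le hs1 (by norm_num : 6 ≤ 8)
        gcongr

theorem norm_dampedFactor_sub_le_of_forall_le (h : P.IsLocalizedNear E M)
    (hξ : ξ ∈ sphere (0 : ℂ) 1) (hζ : ζ ∈ sphere (0 : ℂ) 1) (hs : 0 < s) (hs1 : s ≤ 1)
    (hγ : ∀ γ ∈ P.Γ, s ≤ ‖γ - ξ‖) :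
    ‖P.dampedFactor (1 / (M : ℝ) ^ 2) ξ - P.dampedFactor (1 / (M : ℝ) ^ 2) ζ‖ ≤
      (4 * P.ν.real univ + 4) * (‖ξ - ζ‖ / s ^ 2) := by
  have hξc := sphere_subset_closedBall hξ
  have hζc := sphere_subset_closedBall hζ
  rcases le_or_gt ‖ξ - ζ‖ (s / 2) with ht | ht
  · have hcard : P.S.card * (1 / (M : ℝ) ^ 2) ≤ 1 :=
      h.card_mul_le.trans (div_le_one_of_le₀ h.one_le (Nat.cast_nonneg M))
    have hζγ : ∀ γ ∈ P.Γ, s / 2 ≤ ‖γ - ζ‖ := fun γ hγΓ => by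
      linarith [hγ γ hγΓ, norm_sub_le_norm_sub_add_norm_sub γ ζ ξ, norm_sub_rev ζ ξ]
    calc _ ≤ (2 * P.ν.real univ + 2 * (P.S.card * (1 / (M : ℝ) ^ 2))) * ‖ξ - ζ‖ / (s * (s / 2)) :=
          P.norm_dampedFactor_sub_le_of_dist h.one_div_sq_pos hξc hζc hs (half_pos hs) hγ hζγ
      _ ≤ (2 * P.ν.real univ + 2 * 1) * ‖ξ - ζ‖ / (s * (s / 2)) := by gcongr
      _ = _ := by ring
  · have hts : 1 ≤ 2 * (‖ξ - ζ‖ / s ^ 2) := by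
      rw [← mul_div_assoc, one_le_div (by positivity)]
      linarith [pow_le_of_le_one hs.le hs1 two_ne_zero]
    calc _ ≤ ‖P.dampedFactor (1 / (M : ℝ) ^ 2) ξ‖ + ‖P.dampedFactor (1 / (M : ℝ) ^ 2) ζ‖ :=
          norm_sub_le _ _
      _ ≤ 1 + 1 := add_le_add (P.norm_dampedFactor_le_one h.one_div_sq_pos hξc)
          (P.norm_dampedFactor_le_one h.one_div_sq_pos hζc)
      _ ≤ 4 * (‖ξ - ζ‖ / s ^ 2) := by linarith
      _ ≤ _ := by
          gcongr
          exact le_add_of_nonneg_left (by positivity)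

theorem norm_dampedFactor_sub_le_add (h : P.IsLocalizedNear E M) (hE : IsClosed E)
    (hE1 : E ⊆ sphere 0 1) (hne : E.Nonempty) (hξ : ξ ∈ sphere (0 : ℂ) 1) (hξE : ξ ∉ E)
    (hζ : ζ ∈ sphere (0 : ℂ) 1) :
    ‖P.dampedFactor (1 / (M : ℝ) ^ 2) ξ - P.dampedFactor (1 / (M : ℝ) ^ 2) ζ‖ ≤
      lipSeminorm f * ω ‖ξ - ζ‖ +
        (2 * (P.ν.real univ + P.ν'.real univ) + 4) * 8 ^ 6 *
          (‖ξ - ζ‖ / (infDist ξ E / 2) ^ 8) := by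
  have hd : 0 < infDist ξ E := (hE.notMem_iff_infDist_pos hne).1 hξE
  have hs : 0 < infDist ξ E / 2 := half_pos hd
  have hs1 : infDist ξ E / 2 ≤ 1 := by linarith [infDist_le_two_of_sphere hE1 hne hξ]
  have hM : (0 : ℝ) < M := one_pos.trans_le h.one_le
  rcases le_total (infDist ξ E) (16 / M) with hdM | hdM
  · refine h.norm_dampedFactor_sub_le_of_mul_le hξ hζ hs hs1 ?_
    linarith [(le_div_iff₀ hM).1 hdM]
  · calc _ ≤ (4 * P.ν.real univ + 4) * (‖ξ - ζ‖ / (infDist ξ E / 2) ^ 2) :=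
          h.norm_dampedFactor_sub_le_of_forall_le hξ hζ hs hs1
            fun γ => h.half_le_norm_sub hdM le_rfl
      _ ≤ (2 * (P.ν.real univ + P.ν'.real univ) + 4) * 8 ^ 6 *
          (‖ξ - ζ‖ / (infDist ξ E / 2) ^ 8) := by
          have hpow := pow_le_pow_of_le_one hs.le hs1 (by norm_num : 2 ≤ 8)
          have hν := measureReal_nonneg (μ := P.ν) (s := univ)
          have hν' := measureReal_nonneg (μ := P.ν') (s := univ)
          gcongr
          linarith
      _ ≤ _ := le_add_of_nonneg_left
          (mul_nonneg (lipSeminorm_nonneg f) (ω.nonneg_sphere hξ hζ))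

theorem norm_dampedFactor_sub_mul_le (h : P.IsLocalizedNear E M) (hω : 0 < ω.eta)
    (hE : IsClosed E) (hE1 : E ⊆ sphere 0 1) (hne : E.Nonempty) (hξ : ξ ∈ sphere (0 : ℂ) 1)
    (hξE : ξ ∉ E) (hζ : ζ ∈ sphere (0 : ℂ) 1) :
    ‖P.dampedFactor (1 / (M : ℝ) ^ 2) ξ - P.dampedFactor (1 / (M : ℝ) ^ 2) ζ‖ *
        ω (infDist ξ E) ≤
      (lipSeminorm f * ω 2 + (2 + (2 * (P.ν.real univ + P.ν'.real univ) + 4) * 8 ^ 6) *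
        (2 / ω.eta ^ 3)) * ω ‖ξ - ζ‖ := by
  have hd : 0 < infDist ξ E := (hE.notMem_iff_infDist_pos hne).1 hξE
  have hbound : ‖P.dampedFactor (1 / (M : ℝ) ^ 2) ξ - P.dampedFactor (1 / (M : ℝ) ^ 2) ζ‖ ≤ 2 := by
    linarith [norm_sub_le (P.dampedFactor (1 / (M : ℝ) ^ 2) ξ) (P.dampedFactor (1 / (M : ℝ) ^ 2) ζ),
      P.norm_dampedFactor_le_one h.one_div_sq_pos (sphere_subset_closedBall hξ),
      P.norm_dampedFactor_le_one h.one_div_sq_pos (sphere_subset_closedBall hζ)]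
  have hmul := ω.mul_apply_two_mul_le hω (half_pos hd)
    (by linarith [infDist_le_two_of_sphere hE1 hne hξ]) (norm_nonneg _)
    (norm_sub_le_two_of_sphere hξ hζ) (lipSeminorm_nonneg f) (by positivity) hbound
    (h.norm_dampedFactor_sub_le_add hE hE1 hne hξ hξE hζ)
  rwa [mul_div_cancel₀ _ two_ne_zero] at hmul

end OuterSplitting.IsLocalizedNear

end LipAlgebra

theorem exists_nat_measureReal_cthickening_le {ν : Measure ℂ} [IsFiniteMeasure ν] {E : Set ℂ}
    (hE : IsClosed E) (hνE : ν E = 0) {δ τ : ℝ} (hδ : 0 < δ) (hτ : 0 < τ) :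
    ∃ M : ℕ, 0 < M ∧ 16 / M ≤ δ ∧ 2 * ν.real (cthickening (8 / M) E) + 2 / M ≤ τ := by
  have hdiv : ∀ a : ℝ, Tendsto (fun n : ℕ => a / n) atTop (𝓝 0) :=
    tendsto_const_div_atTop_nhds_zero_nat
  have hmeasure : Tendsto (fun n : ℕ => ν (cthickening (8 / n) E)) atTop (𝓝 0) :=
    hνE ▸ (tendsto_measure_cthickening_of_isClosed ⟨1, one_pos, measure_ne_top _ _⟩ hE).comp
      (hdiv 8)
  have hsum : Tendsto (fun n : ℕ => 2 * ν.real (cthickening (8 / n) E) + 2 / n) atTop (𝓝 0) := by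
    simpa [measureReal_def] using
      (((ENNReal.tendsto_toReal ENNReal.zero_ne_top).comp hmeasure).const_mul 2).add (hdiv 2)
  exact ((eventually_gt_atTop 0).and (((hdiv 16).eventually (eventually_le_nhds hδ)).and
    (hsum.eventually (eventually_le_nhds hτ)))).exists

namespace LipAlgebra

variable {ω : ModulusOfContinuity} {f g : LipAlgebra ω} {ν : Measure ℂ} {E : Set ℂ}

theorem OuterSplitting.IsLocalizedNear.isAlmostOneOff {P : OuterSplitting f} {M : ℕ}
    (h : P.IsLocalizedNear E M) (hω : 0 < ω.eta) (hE : IsClosed E) (hE1 : E ⊆ sphere 0 1)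
    (hne : E.Nonempty) {v : LipAlgebra ω}
    (hv : ∀ z ∈ closedBall (0 : ℂ) 1, lipFun v z = P.dampedFactor (1 / (M : ℝ) ^ 2) z)
    {δ τ : ℝ} (hδ : 0 < δ) (hM : 16 / M ≤ δ)
    (hτ : 2 * P.ν.real univ + 2 / M ≤ min (τ * (δ / 2)) (τ * (ω 2 / 2) * (δ / 2 * (δ / 2)))) :
    IsAlmostOneOff v E (lipSeminorm f * ω 2 +
      (2 + (2 * (P.ν.real univ + P.ν'.real univ) + 4) * 8 ^ 6) * (2 / ω.eta ^ 3)) δ τ := by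
  have hv' : ∀ z ∈ sphere (0 : ℂ) 1, lipFun v z = P.dampedFactor (1 / (M : ℝ) ^ 2) z :=
    fun z hz => hv z (sphere_subset_closedBall hz)
  have hδ2 : 0 < δ / 2 := half_pos hδ
  have hω2 : 0 < ω 2 := ω.pos two_pos le_rfl
  refine ⟨fun z hz => ?_, fun ξ hξ hξE ζ hζ => ?_, fun ξ hξ hd => ?_, fun ξ hξ ζ hζ hdξ hdζ => ?_⟩
  · rw [hv z hz]
    exact P.norm_dampedFactor_le_one h.one_div_sq_pos hz
  · rw [hv' ξ hξ, hv' ζ hζ]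
    exact h.norm_dampedFactor_sub_mul_le hω hE hE1 hne hξ hξE hζ
  · rw [hv' ξ hξ]
    exact (h.norm_one_sub_dampedFactor_le hM hξ hd).trans
      ((div_le_iff₀ hδ2).2 (hτ.trans (min_le_left _ _)))
  · have hτ0 : 0 ≤ τ := nonneg_of_mul_nonneg_left
      ((by positivity : 0 ≤ 2 * P.ν.real univ + 2 / M).trans (hτ.trans (min_le_left _ _))) hδ2
    rw [hv' ξ hξ, hv' ζ hζ]
    calc _ ≤ (2 * P.ν.real univ + 2 / M) / (δ / 2 * (δ / 2)) * ‖ξ - ζ‖ :=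
          h.norm_dampedFactor_sub_le_of_le_infDist hM hξ hζ hdξ hdζ
      _ ≤ τ * (ω 2 / 2) * (2 / ω 2 * ω ‖ξ - ζ‖) := by
          gcongr
          · exact (div_le_iff₀ (mul_pos hδ2 hδ2)).2 (hτ.trans (min_le_right _ _))
          · exact ω.self_le_mul (norm_nonneg _) (norm_sub_le_two_of_sphere hξ hζ)
      _ = τ * ω ‖ξ - ζ‖ := by field_simp

theorem IsRepresentedBy.exists_mem_isAlmostOneOff [IsFiniteMeasure ν] (hf : IsRepresentedBy f ν)
    (hω : 0 < ω.eta) (hE : IsClosed E) (hE1 : E ⊆ sphere 0 1) (hne : E.Nonempty) (hνE : ν E = 0)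
    {K : Ideal (LipAlgebra ω)} (hfK : f ∈ K)
    (hK : ∀ w ∈ closedBall (0 : ℂ) 1, (∀ k ∈ K, lipFun k w = 0) → w ∈ E) :
    ∃ C ≥ 0, ∀ δ > 0, ∀ τ > 0, ∃ v ∈ K, IsAlmostOneOff v E C δ τ := by
  have hω2 : 0 < ω 2 := ω.pos two_pos le_rfl
  have hL := lipSeminorm_nonneg f
  refine ⟨lipSeminorm f * ω 2 + (2 + (2 * ν.real univ + 4) * 8 ^ 6) * (2 / ω.eta ^ 3),
    by positivity, fun δ hδ τ hτ => ?_⟩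
  obtain ⟨M, hM, hMδ, hMτ⟩ := exists_nat_measureReal_cthickening_le hE hνE hδ
    (lt_min (by positivity : 0 < τ * (δ / 2))
      (by positivity : 0 < τ * (ω 2 / 2) * (δ / 2 * (δ / 2))))
  obtain ⟨P, hP, hΓ', hPν, hPsum⟩ := hf.exists_outerSplitting E hM
  obtain ⟨v, hvK, hv⟩ := P.exists_mem_lipFun_eq_dampedFactor hP.one_div_sq_pos hfK
    fun w hw hKw hwΓ' => hΓ' w hwΓ' (hK w hw hKw)
  exact ⟨v, hvK, hPsum ▸ hP.isAlmostOneOff hω hE hE1 hne hv hδ hMδ (by linarith)⟩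

theorem eq_zero_of_forall_mem_ball (h : ∀ z ∈ ball (0 : ℂ) 1, lipFun g z = 0) : g = 0 := by
  refine ext_lipFun fun z hz => ?_
  have hle : supNorm g ≤ 0 := supNorm_le fun w hw => by rw [h w hw, norm_zero]
  rw [← map_zero (algebraMap ℂ (LipAlgebra ω)), lipFun_algebraMap _ hz, ← norm_le_zero_iff]
  exact (norm_lipFun_le g hz).trans hle

theorem IsRepresentedBy.mem_hull_of_forall_mem_colon (hf : IsRepresentedBy f ν)
    {I : Ideal (LipAlgebra ω)} (hgf : f ∈ I.colon {g}) {w : ℂ} (hw : w ∈ closedBall (0 : ℂ) 1)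
    (h : ∀ k ∈ I.colon {g}, lipFun k w = 0) : w ∈ hull I := by
  refine ⟨?_, fun k hk => h k (Submodule.mem_colon_singleton.2 (I.mul_mem_right g hk))⟩
  rw [← ball_union_sphere] at hw
  exact hw.resolve_left fun hwb => hf.ne_zero_of_mem_ball hwb (h f hgf)

theorem IsRepresentedBy.mem_of_mul_mem [IsFiniteMeasure ν] (hf : IsRepresentedBy f ν)
    (hν : ν ≪ arcMeasure) (hω : 0 < ω.eta) {I : Ideal (LipAlgebra ω)} (hI : IsNormClosed I)
    (hg : g ∈ smallSpace ω (hull I)) (hgf : g * f ∈ I) : g ∈ I := by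
  have hE := isClosed_hull I
  have hE1 : hull I ⊆ sphere 0 1 := fun ξ hξ => hξ.1
  have mem_colon : ∀ k, k ∈ I.colon {g} ↔ g * k ∈ I := fun k => by
    rw [Submodule.mem_colon_singleton, smul_eq_mul, mul_comm]
  have hfK : f ∈ I.colon {g} := (mem_colon f).2 hgf
  have hK := fun w hw => hf.mem_hull_of_forall_mem_colon hfK (w := w) hw
  rcases (hull I).eq_empty_or_nonempty with hempty | hne
  · have hone : 1 ∈ I.colon {g} := mem_of_mul_mem_of_forall_ne_zero (v := f)
      (by rwa [one_mul]) fun w hw hKw => absurd (hempty ▸ hK w hw hKw) (notMem_empty w)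
    simpa only [mul_one] using (mem_colon 1).1 hone
  rcases eq_or_ne (arcMeasure (hull I)) 0 with hnull | hpos
  · obtain ⟨C, hC, hunit⟩ :=
      hf.exists_mem_isAlmostOneOff hω hE hE1 hne (hν hnull) hfK hK
    refine mem_of_forall_exists_isAlmostOneOff hI hE hE1 hne hg hC fun δ hδ τ hτ => ?_
    obtain ⟨v, hvK, hv⟩ := hunit δ hδ τ hτ
    exact ⟨v, (mem_colon v).1 hvK, hv⟩
  · rw [eq_zero_of_forall_mem_ball fun z hz => eq_zero_of_eqOn_zero_of_arcMeasure_pos hE hE1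
      (pos_iff_ne_zero.2 hpos) (diffContOnCl_lipFun g) hg.1 hz]
    exact I.zero_mem

end LipAlgebra

theorem proposition1 (ω : ModulusOfContinuity) (hω : 0 < ω.eta)
    (I : Ideal (LipAlgebra ω)) (hI : LipAlgebra.IsNormClosed I)
    (g : LipAlgebra ω) (hg : g ∈ LipAlgebra.smallSpace ω (LipAlgebra.hull I))
    (f : LipAlgebra ω) (hf : LipAlgebra.IsOuter f) (hgf : g * f ∈ I) :
    g ∈ I := by
  obtain ⟨a, ν, hfin, hν, haf⟩ := hf.exists_isRepresentedBy
  refine haf.mem_of_mul_mem hν hω hI hg ?_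
  rw [mul_left_comm]
  exact I.mul_mem_left _ hgf
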